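/- Let $k \ge 3$ and let $F_k$ be the free group on $k$ generators $x_1,\dots,x_k$. The length of an element of $F_k$ is the length of the reduced word in $x_1^{\pm1},\dots,x_k^{\pm1}$ representing it. An element is primitive if it belongs to some free generating set of $F_k$, and a subgroup $H \le F_k$ is a free factor if $F_k = H * K$ for some subgroup $K \le F_k$; it is a proper free factor if moreover $H \ne F_k$. For $N \ge 0$ let $P_{k,N}$ be the set of primitive elements of length $N$ in $F_k$, and let $S_{k,N}$ be the set of elements of length $N$ in $F_k$ that are contained in some proper free factor of $F_k$. Then \[ \lim_{N\to\infty}\sqrt[N]{|S_{k,N}|}=\lim_{N\to\infty}\sqrt[N]{|S_{k,N}\setminus P_{k,N}|}=2k-3 , \] where both limits exist. -/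

import Mathlib

universe u

/-- An element of a group `G` is primitive if it belongs to some free generating set of `G`. -/
def IsPrimitive {G : Type u} [Group G] (w : G) : Prop :=
  ∃ (ι : Type u) (b : FreeGroupBasis ι G), w ∈ Set.range b

/-- A subgroup `H` of `G` is a free factor if there is a subgroup `K` of `G` such that `G` is the
internal free product `H * K`: the canonical homomorphism from the free product of `H` and `K`
to `G` is bijective. -/
def IsFreeFactor {G : Type u} [Group G] (H : Subgroup G) : Prop :=
  ∃ K : Subgroup G, Function.Bijective (Monoid.Coprod.lift H.subtype K.subtype)

/-- The set of primitive elements of reduced word length `N` in the free group on `k` letters. -/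
def primitiveWords (k N : ℕ) : Set (FreeGroup (Fin k)) :=
  {w | w.norm = N ∧ IsPrimitive w}

/-- The set of elements of reduced word length `N` in the free group on `k` letters that are
contained in some proper free factor. -/
def properFreeFactorWords (k N : ℕ) : Set (FreeGroup (Fin k)) :=
  {w | w.norm = N ∧ ∃ H : Subgroup (FreeGroup (Fin k)), IsFreeFactor H ∧ H ≠ ⊤ ∧ w ∈ H}

/-- These sets are finite, so that `Set.ncard` is their true cardinality. -/
theorem properFreeFactorWords_finite (k N : ℕ) : (properFreeFactorWords k N).Finite := by
  refine Set.Finite.subset (Set.Finite.preimage (f := FreeGroup.toWord)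
    FreeGroup.toWord_injective.injOn (List.finite_length_eq (Fin k × Bool) N)) ?_
  rintro w ⟨hw, -⟩
  exact hw

/-!
An element of a proper free factor of the free group on `α` lies in `⟨B⟩` for some set `B` with
`B ∪ {b}` generating and `#B < |α|`; up to conjugation, which costs only a bounded factor per
letter since `2 k ≤ (2 k - 3) ^ 2`, its reduced word is cyclically reduced. Such a word labels a
closed path in the rose on `B`. Fold this graph one pair of darts at a time. If the path still
uses more than `D` edges when no fold is left, attach a loop labelled `b` and go on: as `B ∪ {b}`
generates, folding cannot end before the rose with `|α|` petals, so at some moment the path uses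
exactly `D` edges of a graph of rank at most `|α|`.

A path of length `N` uses some darts of such a graph rarely. By the choice of a scale, the darts
it uses frequently form a proper subgraph without leaves, whose degrees are then at most
`2 |α| - 2`, while the graph has few vertices of degree above two compared with `D`. So all but
`O(N / D)` of the letters are chosen among at most `2 |α| - 3`, and the number of words is at most
`(2 |α| - 3 + ε) ^ N` up to a constant, once `D` is large.

Conversely, a reduced word in all generators but one lies in a proper free factor, and with
boundedly many more letters all its exponent sums become divisible by `3`, so that no homomorphism
to `ℤ / 3` detects it; a primitive element is detected by some.
-/

open scoped Finset

/-! ### Labelled graphs and folding -/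

section LabeledGraph

variable {V W α : Type*}

/-- The reversal of the dart `(u, l, v)`, which runs from `u` to `v` and is labelled by the
letter `l`, a generator (`true`) or the inverse of a generator (`false`). -/
def revDart (x : V × (α × Bool) × V) : V × (α × Bool) × V := (x.2.2, (x.2.1.1, !x.2.1.2), x.1)

theorem revDart_involutive : Function.Involutive (revDart : V × (α × Bool) × V → _) := by
  rintro ⟨u, ⟨a, b⟩, v⟩
  simp [revDart]

theorem revDart_ne (x : V × (α × Bool) × V) : revDart x ≠ x := by
  obtain ⟨u, ⟨a, b⟩, v⟩ := x
  simp [revDart]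

theorem even_card_of_involutive {X : Type*} {f : X → X} (hf : Function.Involutive f)
    (hne : ∀ x, f x ≠ x) {s : Finset X} (hs : ∀ x ∈ s, f x ∈ s) : Even #s := by
  have : ∑ _x ∈ s, (1 : ZMod 2) = 0 :=
    Finset.sum_involution (fun x _ => f x) (fun _ _ => by decide) (fun x _ _ => hne x) hs
      fun x _ => hf x
  rw [Finset.sum_const, nsmul_eq_mul, mul_one] at this
  exact ZMod.natCast_eq_zero_iff_even.1 this

/-- A finite graph whose edges are labelled by `α`, in the style of Serre: every edge is given by
two mutually reversed darts, so that there are twice as many darts as edges. -/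
structure LabeledGraph (V α : Type*) where
  verts : Finset V
  darts : Finset (V × (α × Bool) × V)
  fst_mem : ∀ x ∈ darts, x.1 ∈ verts
  revDart_mem : ∀ x ∈ darts, revDart x ∈ darts

namespace LabeledGraph

variable {G H : LabeledGraph V α} {o u v : V} {l : α × Bool} {L : List (α × Bool)}

instance : Preorder (LabeledGraph V α) := Preorder.lift fun G => (G.verts, G.darts)

theorem verts_subset (h : G ≤ H) : G.verts ⊆ H.verts := h.1

theorem darts_subset (h : G ≤ H) : G.darts ⊆ H.darts := h.2

theorem snd_mem (h : (u, l, v) ∈ G.darts) : v ∈ G.verts := G.fst_mem _ (G.revDart_mem _ h)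

theorem even_card_darts (G : LabeledGraph V α) : Even #G.darts :=
  even_card_of_involutive revDart_involutive revDart_ne G.revDart_mem

/-- The Betti number (number of edges minus number of vertices plus one) is at most `r`. -/
def RankLE (G : LabeledGraph V α) (r : ℕ) : Prop := #G.darts + 2 ≤ 2 * #G.verts + 2 * r

/-- The word `L` labels a path from `u` to `v` in `G`. -/
def IsPath (G : LabeledGraph V α) : V → List (α × Bool) → V → Prop
  | u, [], v => u = v
  | u, l :: L, v => ∃ x, (u, l, x) ∈ G.darts ∧ G.IsPath x L v

theorem isPath_append {L₁ L₂ : List (α × Bool)} :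
    G.IsPath u (L₁ ++ L₂) v ↔ ∃ x, G.IsPath u L₁ x ∧ G.IsPath x L₂ v := by
  induction L₁ generalizing u with
  | nil => simp [IsPath]
  | cons l L ih =>
    simp only [List.cons_append, IsPath, ih]
    tauto

theorem isPath_singleton : G.IsPath u [l] v ↔ (u, l, v) ∈ G.darts := by
  simp [IsPath]

theorem IsPath.invRev (h : G.IsPath u L v) : G.IsPath v (FreeGroup.invRev L) u := by
  induction L generalizing u with
  | nil => exact h.symm
  | cons l L ih =>
    obtain ⟨x, hx, hL⟩ := h
    rw [FreeGroup.invRev_cons, isPath_append]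
    exact ⟨x, ih hL, isPath_singleton.2 (G.revDart_mem _ hx)⟩

theorem IsPath.mono (hGH : G ≤ H) (h : G.IsPath u L v) : H.IsPath u L v := by
  induction L generalizing u with
  | nil => exact h
  | cons l L ih =>
    obtain ⟨x, hx, hL⟩ := h
    exact ⟨x, darts_subset hGH hx, ih hL⟩

theorem IsPath.exists_crossing {S : Finset V} (h : G.IsPath u L v) (hu : u ∈ S) (hv : v ∉ S) :
    ∃ x ∈ S, ∃ y ∉ S, ∃ l, (x, l, y) ∈ G.darts := by
  induction L generalizing u with
  | nil => exact absurd (h ▸ hu) hv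
  | cons l L ih =>
    obtain ⟨x, hx, hL⟩ := h
    by_cases hxS : x ∈ S
    · exact ih hL hxS
    · exact ⟨u, hu, x, hxS, l, hx⟩

theorem IsPath.exists_vertices {m : ℕ} {w : Fin m → α × Bool} (h : G.IsPath u (List.ofFn w) v) :
    ∃ q : Fin (m + 1) → V, q 0 = u ∧ q (Fin.last m) = v ∧
      ∀ i : Fin m, (q i.castSucc, w i, q i.succ) ∈ G.darts := by
  induction m generalizing u with
  | zero => exact ⟨fun _ => u, rfl, by simpa [IsPath] using h, fun i => i.elim0⟩
  | succ m ih =>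
    rw [List.ofFn_succ] at h
    obtain ⟨x, hx, hL⟩ := h
    obtain ⟨q, rfl, hlast, hq⟩ := ih hL
    refine ⟨Fin.cons u q, rfl, hlast, Fin.cases hx hq⟩

/-- No two darts with the same label and the same origin. -/
def IsFolded (G : LabeledGraph V α) : Prop :=
  ∀ ⦃u l a b⦄, (u, l, a) ∈ G.darts → (u, l, b) ∈ G.darts → a = b

theorem IsFolded.path_unique (hG : G.IsFolded) {v' : V} (h : G.IsPath u L v)
    (h' : G.IsPath u L v') : v = v' := by
  induction L generalizing u with
  | nil => exact h.symm.trans h'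
  | cons l L ih =>
    obtain ⟨x, hx, hL⟩ := h
    obtain ⟨x', hx', hL'⟩ := h'
    obtain rfl := hG hx hx'
    exact ih hL hL'

theorem IsFolded.path_red (hG : G.IsFolded) {L' : List (α × Bool)} (h : G.IsPath u L v)
    (hr : FreeGroup.Red L L') : G.IsPath u L' v := by
  induction hr with
  | refl => exact h
  | tail _ hs ih =>
    rcases hs with @⟨L₁, L₂, a, b⟩
    rw [isPath_append] at ih ⊢
    obtain ⟨y, h₁, z, hz, t, ht, h₂⟩ := ih
    obtain rfl : y = t := hG (G.revDart_mem _ hz) ht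
    exact ⟨y, h₁, h₂⟩

theorem IsFolded.path_toWord [DecidableEq α] (hG : G.IsFolded) (h : G.IsPath u L v) :
    G.IsPath u (FreeGroup.mk L).toWord v :=
  hG.path_red h FreeGroup.reduce.red

/-- The graph `G` is connected and `o` is one of its vertices. -/
structure IsConnected (G : LabeledGraph V α) (o : V) : Prop where
  base_mem : o ∈ G.verts
  reach : ∀ v ∈ G.verts, ∃ L, G.IsPath o L v

/-- The subgroup of labels of closed paths at `o`. -/
def loopSubgroup (G : LabeledGraph V α) (o : V) : Subgroup (FreeGroup α) where
  carrier := {g | ∃ L, FreeGroup.mk L = g ∧ G.IsPath o L o}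
  one_mem' := ⟨[], rfl, rfl⟩
  mul_mem' := by
    rintro _ _ ⟨L, rfl, h⟩ ⟨L', rfl, h'⟩
    exact ⟨L ++ L', FreeGroup.mul_mk.symm, isPath_append.2 ⟨o, h, h'⟩⟩
  inv_mem' := by
    rintro _ ⟨L, rfl, h⟩
    exact ⟨FreeGroup.invRev L, FreeGroup.inv_mk.symm, h.invRev⟩

theorem loopSubgroup_mono (h : G ≤ H) (o : V) : G.loopSubgroup o ≤ H.loopSubgroup o := by
  rintro _ ⟨L, rfl, hL⟩
  exact ⟨L, rfl, hL.mono h⟩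

theorem IsFolded.isPath_toWord_of_mem_loopSubgroup [DecidableEq α] (hG : G.IsFolded)
    {g : FreeGroup α} (hg : g ∈ G.loopSubgroup o) : G.IsPath o g.toWord o := by
  obtain ⟨L, rfl, hL⟩ := hg
  exact hG.path_toWord hL

theorem IsFolded.verts_eq_singleton (hG : G.IsFolded) (h : G.IsConnected o)
    (ht : G.loopSubgroup o = ⊤) : G.verts = {o} := by
  classical
  refine Finset.eq_singleton_iff_unique_mem.2 ⟨h.base_mem, fun v hv => ?_⟩
  obtain ⟨L, hL⟩ := h.reach v hv
  exact hG.path_unique (hG.path_toWord hL)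
    (hG.isPath_toWord_of_mem_loopSubgroup (ht ▸ Subgroup.mem_top _))

theorem IsFolded.two_mul_card_le [Fintype α] (hG : G.IsFolded) (ht : G.loopSubgroup o = ⊤) :
    2 * Fintype.card α ≤ #G.darts := by
  classical
  have hof (a : α) : (o, (a, true), o) ∈ G.darts := by
    have := hG.isPath_toWord_of_mem_loopSubgroup (ht ▸ Subgroup.mem_top (FreeGroup.of a))
    rwa [FreeGroup.toWord_of, isPath_singleton] at this
  have hcard : #(Finset.univ : Finset (α × Bool)) = 2 * Fintype.card α := by
    simp [mul_comm]
  rw [← hcard]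
  refine Finset.card_le_card_of_injOn (fun l => (o, l, o)) ?_ (by intro; simp)
  rintro ⟨a, _ | _⟩ -
  · exact G.revDart_mem _ (hof a)
  · exact hof a

section Map

variable [DecidableEq W] [DecidableEq α] (f : V → W)

/-- The image of a labelled graph under a map of vertices. -/
def map (G : LabeledGraph V α) : LabeledGraph W α where
  verts := G.verts.image f
  darts := G.darts.image (Prod.map f (Prod.map id f))
  fst_mem := by
    intro x hx
    obtain ⟨y, hy, rfl⟩ := Finset.mem_image.1 hx
    exact Finset.mem_image_of_mem f (G.fst_mem y hy)
  revDart_mem := by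
    intro x hx
    obtain ⟨y, hy, rfl⟩ := Finset.mem_image.1 hx
    exact Finset.mem_image.2 ⟨revDart y, G.revDart_mem y hy, rfl⟩

theorem IsPath.map (h : G.IsPath u L v) : (G.map f).IsPath (f u) L (f v) := by
  induction L generalizing u with
  | nil => exact congrArg f h
  | cons l L ih =>
    obtain ⟨x, hx, hL⟩ := h
    exact ⟨f x, Finset.mem_image_of_mem (Prod.map f (Prod.map id f)) hx, ih hL⟩

theorem IsConnected.map (h : G.IsConnected o) : (G.map f).IsConnected (f o) where
  base_mem := Finset.mem_image_of_mem f h.base_mem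
  reach := by
    intro v hv
    obtain ⟨u, hu, rfl⟩ := Finset.mem_image.1 hv
    obtain ⟨L, hL⟩ := h.reach u hu
    exact ⟨L, hL.map f⟩

theorem loopSubgroup_le_map (G : LabeledGraph V α) (o : V) :
    G.loopSubgroup o ≤ (G.map f).loopSubgroup (f o) := by
  rintro _ ⟨L, rfl, hL⟩
  exact ⟨L, rfl, hL.map f⟩

theorem map_mono (h : G ≤ H) : G.map f ≤ H.map f :=
  ⟨Finset.image_subset_image (verts_subset h), Finset.image_subset_image (darts_subset h)⟩

end Map

section Fold

variable [DecidableEq V] [DecidableEq α]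

theorem verts_map_update_id {a b : V} (ha : a ∈ G.verts) (hab : a ≠ b) :
    (G.map (Function.update id b a)).verts = G.verts.erase b := by
  ext v
  simp only [map, Finset.mem_image, Finset.mem_erase]
  constructor
  · rintro ⟨u, hu, rfl⟩
    rcases eq_or_ne u b with rfl | hub
    · simpa [hab] using ha
    · simpa [Function.update_of_ne hub] using ⟨hub, hu⟩
  · rintro ⟨hvb, hv⟩
    exact ⟨v, hv, by simp [hvb]⟩

theorem exists_fold_of_not_isFolded (hG : ¬ G.IsFolded) :
    ∃ a b, #(G.map (Function.update id b a)).verts + 1 = #G.verts ∧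
      #(G.map (Function.update id b a)).darts + 2 ≤ #G.darts := by
  unfold IsFolded at hG
  push Not at hG
  obtain ⟨u, l, a, b, ha, hb, hab⟩ := hG
  refine ⟨a, b, ?_, ?_⟩
  · rw [verts_map_update_id (snd_mem ha) hab, Finset.card_erase_add_one (snd_mem hb)]
  have hlt : #(G.map (Function.update id b a)).darts < #G.darts := by
    refine lt_of_le_of_ne Finset.card_image_le fun hc => hab ?_
    have := Finset.card_image_iff.1 hc ha hb (by simp [hab])
    simpa using this
  obtain ⟨c, hc⟩ := (G.map (Function.update id b a)).even_card_darts
  obtain ⟨d, hd⟩ := G.even_card_darts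
  omega

end Fold

theorem IsConnected.exists_folded (h : G.IsConnected o) :
    ∃ (G' : LabeledGraph V α) (o' : V), G'.IsConnected o' ∧ G'.IsFolded ∧
      #G'.darts + 2 * #G.verts ≤ #G.darts + 2 * #G'.verts ∧
      G.loopSubgroup o ≤ G'.loopSubgroup o' := by
  classical
  induction hn : #G.verts generalizing G o with
  | zero => exact absurd hn (Finset.card_ne_zero_of_mem h.base_mem)
  | succ n ih =>
    by_cases hG : G.IsFolded
    · exact ⟨G, o, h, hG, by omega, le_rfl⟩
    obtain ⟨a, b, hverts, hdarts⟩ := exists_fold_of_not_isFolded hG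
    obtain ⟨G', o', h', hf, hr, hl⟩ := ih (h.map (Function.update id b a)) (by omega)
    exact ⟨G', o', h', hf, by omega, (loopSubgroup_le_map _ G o).trans hl⟩

theorem IsConnected.two_mul_card_add_le [Fintype α] (h : G.IsConnected o)
    (ht : G.loopSubgroup o = ⊤) : 2 * #G.verts + 2 * Fintype.card α ≤ #G.darts + 2 := by
  obtain ⟨G', o', h', hf, hr, hl⟩ := h.exists_folded
  have ht' : G'.loopSubgroup o' = ⊤ := top_le_iff.1 (ht ▸ hl)
  have hdarts := hf.two_mul_card_le ht'
  have hverts : #G'.verts = 1 := by simp [hf.verts_eq_singleton h' ht']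
  omega

/-- The graph with a single vertex and no edges. -/
def point (o : V) : LabeledGraph V α where
  verts := {o}
  darts := ∅
  fst_mem := by simp
  revDart_mem := by simp

theorem isConnected_point (o : V) : (point o : LabeledGraph V α).IsConnected o where
  base_mem := Finset.mem_singleton_self o
  reach _ hv := ⟨[], (Finset.mem_singleton.1 hv).symm⟩

section InsertDart

variable [DecidableEq V] [DecidableEq α]

/-- The graph `G` with a further edge from `u` to `v` labelled by `l`, adding `u` and `v` to the
vertices if necessary. -/
def insertDart (G : LabeledGraph V α) (u : V) (l : α × Bool) (v : V) : LabeledGraph V α where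
  verts := insert u (insert v G.verts)
  darts := insert (u, l, v) (insert (revDart (u, l, v)) G.darts)
  fst_mem := by
    refine Finset.forall_mem_insert _ _ _ |>.2 ⟨?_, Finset.forall_mem_insert _ _ _ |>.2 ⟨?_, ?_⟩⟩
    · exact Finset.mem_insert_self u _
    · exact Finset.mem_insert_of_mem (Finset.mem_insert_self v _)
    · exact fun x hx => Finset.mem_insert_of_mem (Finset.mem_insert_of_mem (G.fst_mem x hx))
  revDart_mem := by
    refine Finset.forall_mem_insert _ _ _ |>.2 ⟨?_, Finset.forall_mem_insert _ _ _ |>.2 ⟨?_, ?_⟩⟩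
    · exact Finset.mem_insert_of_mem (Finset.mem_insert_self _ _)
    · rw [revDart_involutive]
      exact Finset.mem_insert_self _ _
    · exact fun x hx => Finset.mem_insert_of_mem (Finset.mem_insert_of_mem (G.revDart_mem x hx))

theorem le_insertDart (G : LabeledGraph V α) (u : V) (l : α × Bool) (v : V) :
    G ≤ G.insertDart u l v :=
  ⟨(Finset.subset_insert _ _).trans (Finset.subset_insert _ _),
    (Finset.subset_insert _ _).trans (Finset.subset_insert _ _)⟩

theorem mem_darts_insertDart (G : LabeledGraph V α) (u : V) (l : α × Bool) (v : V) :
    (u, l, v) ∈ (G.insertDart u l v).darts := Finset.mem_insert_self _ _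

theorem IsConnected.insertDart (h : G.IsConnected o) (hu : u ∈ G.verts) (l : α × Bool) (v : V) :
    (G.insertDart u l v).IsConnected o where
  base_mem := verts_subset (G.le_insertDart u l v) h.base_mem
  reach x hx := by
    have hold : ∀ y ∈ G.verts, ∃ L, (G.insertDart u l v).IsPath o L y := fun y hy =>
      (h.reach y hy).imp fun L hL => hL.mono (G.le_insertDart u l v)
    obtain ⟨L, hL⟩ := hold u hu
    rcases Finset.mem_insert.1 hx with rfl | hx
    · exact ⟨L, hL⟩
    rcases Finset.mem_insert.1 hx with rfl | hx
    · exact ⟨L ++ [l], isPath_append.2 ⟨u, hL, isPath_singleton.2 (G.mem_darts_insertDart u l x)⟩⟩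
    · exact hold x hx

theorem RankLE.insertDart {r : ℕ} (h : G.RankLE r) (u : V) (l : α × Bool) (v : V) :
    (G.insertDart u l v).RankLE (r + 1) := by
  have hverts := Finset.card_le_card (verts_subset (G.le_insertDart u l v))
  have hdarts : #(G.insertDart u l v).darts ≤ #G.darts + 2 :=
    (Finset.card_insert_le _ _).trans (Nat.add_le_add_right (Finset.card_insert_le _ _) 1)
  unfold RankLE at h ⊢
  omega

theorem rankLE_insertDart_iff (hu : u ∈ G.verts) (hv : v ∉ G.verts) {r : ℕ} :
    (G.insertDart u l v).RankLE r ↔ G.RankLE r := by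
  have hverts : #(G.insertDart u l v).verts = #G.verts + 1 := by
    have : (G.insertDart u l v).verts = insert v G.verts :=
      Finset.insert_eq_of_mem (Finset.mem_insert_of_mem hu)
    rw [this, Finset.card_insert_of_notMem hv]
  have hdarts : #(G.insertDart u l v).darts = #G.darts + 2 := by
    have hrev : revDart (u, l, v) ∉ G.darts := fun h => hv (G.fst_mem _ h)
    have hdart : (u, l, v) ∉ insert (revDart (u, l, v)) G.darts := by
      rw [Finset.mem_insert, not_or]
      exact ⟨fun h => revDart_ne _ h.symm, fun h => hv (snd_mem h)⟩
    rw [insertDart, Finset.card_insert_of_notMem hdart, Finset.card_insert_of_notMem hrev]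
  unfold RankLE
  omega

end InsertDart

theorem RankLE.mono {r : ℕ} (hG : G.RankLE r) (h : G.IsConnected o) (hHG : H ≤ G)
    (hne : H.verts.Nonempty) : H.RankLE r := by
  classical
  induction hn : #(G.verts \ H.verts) generalizing H with
  | zero =>
    have hverts : H.verts = G.verts :=
      (verts_subset hHG).antisymm (Finset.sdiff_eq_empty_iff_subset.1 (Finset.card_eq_zero.1 hn))
    have hdarts := Finset.card_le_card (darts_subset hHG)
    unfold RankLE at hG ⊢
    rw [hverts]
    omega
  | succ n ih =>
    obtain ⟨v, hv⟩ : (G.verts \ H.verts).Nonempty := Finset.card_pos.1 (by omega)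
    rw [Finset.mem_sdiff] at hv
    obtain ⟨s, hs⟩ := hne
    obtain ⟨L₁, h₁⟩ := h.reach s (verts_subset hHG hs)
    obtain ⟨L₂, h₂⟩ := h.reach v hv.1
    obtain ⟨x, hx, y, hy, l, hl⟩ :=
      IsPath.exists_crossing (isPath_append.2 ⟨o, h₁.invRev, h₂⟩) hs hv.2
    have hverts : (H.insertDart x l y).verts = insert y H.verts :=
      Finset.insert_eq_of_mem (Finset.mem_insert_of_mem hx)
    refine (rankLE_insertDart_iff (l := l) hx hy).1 (ih ⟨?_, ?_⟩ ?_ ?_)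
    · change (H.insertDart x l y).verts ⊆ G.verts
      exact hverts ▸ Finset.insert_subset (snd_mem hl) (verts_subset hHG)
    · exact Finset.insert_subset hl (Finset.insert_subset (G.revDart_mem _ hl)
        (darts_subset hHG))
    · exact Finset.insert_nonempty _ _
    · rw [hverts, Finset.sdiff_insert,
        Finset.card_erase_of_mem (Finset.mem_sdiff.2 ⟨snd_mem hl, hy⟩), hn, Nat.add_sub_cancel]

theorem IsConnected.exists_attach [Infinite V] (h : G.IsConnected o) (hu : u ∈ G.verts)
    (hv : v ∈ G.verts) {r : ℕ} (hr : G.RankLE r) (l : α × Bool) (L : List (α × Bool)) :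
    ∃ G' ≥ G, G'.IsConnected o ∧ G'.RankLE (r + 1) ∧ G'.IsPath u (l :: L) v := by
  classical
  induction L generalizing G u l with
  | nil =>
    exact ⟨G.insertDart u l v, G.le_insertDart u l v, h.insertDart hu l v, hr.insertDart u l v,
      v, G.mem_darts_insertDart u l v, rfl⟩
  | cons l' L ih =>
    obtain ⟨x, hx⟩ := Infinite.exists_notMem_finset G.verts
    have hle := G.le_insertDart u l x
    obtain ⟨G', hG', hc, hr', hp⟩ := ih (h.insertDart hu l x)
      (snd_mem (G.mem_darts_insertDart u l x)) (verts_subset hle hv)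
      ((rankLE_insertDart_iff hu hx).2 hr) l'
    exact ⟨G', hle.trans hG', hc, hr', x, darts_subset hG' (G.mem_darts_insertDart u l x), hp⟩

theorem IsConnected.exists_attach_loop [Infinite V] (h : G.IsConnected o) {r : ℕ}
    (hr : G.RankLE r) (g : FreeGroup α) :
    ∃ G' ≥ G, G'.IsConnected o ∧ G'.RankLE (r + 1) ∧ g ∈ G'.loopSubgroup o := by
  classical
  rcases hg : g.toWord with _ | ⟨l, L⟩
  · rw [FreeGroup.toWord_eq_nil_iff] at hg
    exact ⟨G, le_rfl, h, by unfold RankLE at hr ⊢; omega, hg ▸ one_mem _⟩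
  · obtain ⟨G', hG', hc, hr', hp⟩ := h.exists_attach h.base_mem h.base_mem hr l L
    exact ⟨G', hG', hc, hr', l :: L, by rw [← hg, FreeGroup.mk_toWord], hp⟩

theorem exists_isConnected [Infinite V] (B : Finset (FreeGroup α)) :
    ∃ (G : LabeledGraph V α) (o : V), G.IsConnected o ∧ G.RankLE #B ∧
      Subgroup.closure ↑B ≤ G.loopSubgroup o := by
  classical
  induction B using Finset.induction_on with
  | empty =>
    obtain ⟨o⟩ : Nonempty V := inferInstance
    exact ⟨point o, o, isConnected_point o, by simp [RankLE, point], by simp⟩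
  | insert g B hg ih =>
    obtain ⟨G, o, hc, hr, hB⟩ := ih
    obtain ⟨G', hG', hc', hr', hmem⟩ := hc.exists_attach_loop hr g
    refine ⟨G', o, hc', by rwa [Finset.card_insert_of_notMem hg], ?_⟩
    rw [Finset.coe_insert, Subgroup.closure_le, Set.insert_subset_iff, ← Subgroup.closure_le]
    exact ⟨hmem, hB.trans (loopSubgroup_mono hG' o)⟩

section Traced

variable [DecidableEq V] [DecidableEq W] [DecidableEq α] {n : ℕ}

/-- The `i`-th dart of the closed path with vertices `p 0, ..., p n, p 0` that reads the cyclic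
word `w`; the index `i + 1` wraps around. -/
def cyclicDart (w : Fin (n + 1) → α × Bool) (p : Fin (n + 1) → V) (i : Fin (n + 1)) :
    V × (α × Bool) × V := (p i, w i, p (i + 1))

/-- The graph formed by the vertices and edges of a closed path. -/
def traced (w : Fin (n + 1) → α × Bool) (p : Fin (n + 1) → V) : LabeledGraph V α where
  verts := Finset.univ.image p
  darts := Finset.univ.image (cyclicDart w p) ∪ Finset.univ.image (revDart ∘ cyclicDart w p)
  fst_mem := by
    intro x hx
    simp only [Finset.mem_union, Finset.mem_image, Finset.mem_univ, true_and] at hx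
    rcases hx with ⟨i, rfl⟩ | ⟨i, rfl⟩ <;> exact Finset.mem_image_of_mem p (Finset.mem_univ _)
  revDart_mem := by
    intro x hx
    simp only [Finset.mem_union, Finset.mem_image, Finset.mem_univ, true_and,
      Function.comp_apply] at hx ⊢
    rcases hx with ⟨i, rfl⟩ | ⟨i, rfl⟩
    · exact .inr ⟨i, rfl⟩
    · exact .inl ⟨i, (revDart_involutive _).symm⟩

variable {w : Fin (n + 1) → α × Bool} {p : Fin (n + 1) → V}

theorem mem_darts_traced {x : V × (α × Bool) × V} :
    x ∈ (traced w p).darts ↔ (∃ i, cyclicDart w p i = x) ∨ ∃ i, cyclicDart w p i = revDart x := by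
  simp [traced, revDart_involutive.eq_iff]

theorem traced_le (h : ∀ i, cyclicDart w p i ∈ G.darts) : traced w p ≤ G := by
  refine ⟨Finset.image_subset_iff.2 fun i _ => G.fst_mem _ (h i), fun x hx => ?_⟩
  rcases mem_darts_traced.1 hx with ⟨i, rfl⟩ | ⟨i, hi⟩
  · exact h i
  · exact revDart_involutive x ▸ G.revDart_mem _ (hi ▸ h i)

theorem traced_comp (f : V → W) (w : Fin (n + 1) → α × Bool) (p : Fin (n + 1) → V) :
    traced w (f ∘ p) = (traced w p).map f := by
  simp only [traced, map, Finset.image_image, Finset.image_union]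
  rfl

theorem RankLE.traced {r : ℕ} (hG : G.RankLE r) (h : G.IsConnected o) (hp : traced w p ≤ G) :
    (traced w p).RankLE r :=
  hG.mono h hp (Finset.univ_nonempty.image p)

theorem IsPath.exists_traced_le (h : G.IsPath u (List.ofFn w) u) :
    ∃ p : Fin (n + 1) → V, LabeledGraph.traced w p ≤ G := by
  obtain ⟨q, h0, hlast, hq⟩ := h.exists_vertices
  refine ⟨fun i => q i.castSucc, traced_le fun i => ?_⟩
  have hsucc : q (i + 1).castSucc = q i.succ := by
    cases i using Fin.lastCases with
    | last => rw [Fin.last_add_one, Fin.castSucc_zero, h0, Fin.succ_last, hlast]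
    | cast j => rw [Fin.coeSucc_eq_succ, Fin.succ_castSucc]
  rw [cyclicDart, hsucc]
  exact hq i

theorem card_image_add_card_le {X Y : Type*} [DecidableEq Y] {s t : Finset X} (hst : s ⊆ t)
    (f : X → Y) : #(t.image f) + #s ≤ #(s.image f) + #t := by
  classical
  have hunion : t.image f = s.image f ∪ (t \ s).image f := by
    rw [← Finset.image_union, Finset.union_sdiff_of_subset hst]
  have hle := (Finset.card_union_le (s.image f) _).trans
    (Nat.add_le_add_left (Finset.card_image_le (s := t \ s) (f := f)) _)
  have := Finset.card_sdiff_add_card_eq_card hst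
  rw [hunion]
  omega

/- A connected graph of rank `card α` carrying the whole free group loses exactly one edge in each
fold, so the number of traced edges drops by at most one at a time, from any initial value down to
at most `card α` in the folded graph. -/
theorem IsConnected.exists_card_darts_traced_eq [Fintype α] (h : G.IsConnected o)
    (ht : G.loopSubgroup o = ⊤) (hr : G.RankLE (Fintype.card α)) (hp : traced w p ≤ G) {D : ℕ}
    (hD : Fintype.card α ≤ D) (hDp : 2 * D ≤ #(traced w p).darts) :
    ∃ q : Fin (n + 1) → V, #(traced w q).darts = 2 * D ∧
      (traced w q).RankLE (Fintype.card α) := by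
  induction hn : #G.verts generalizing G o p with
  | zero => exact absurd hn (Finset.card_ne_zero_of_mem h.base_mem)
  | succ m ih =>
    rcases hDp.eq_or_lt with heq | hlt
    · exact ⟨p, heq.symm, hr.traced h hp⟩
    by_cases hG : G.IsFolded
    · have hverts : #G.verts = 1 := by simp [hG.verts_eq_singleton h ht]
      have hdarts := Finset.card_le_card (darts_subset hp)
      unfold RankLE at hr
      omega
    obtain ⟨a, b, hverts, hdarts⟩ := exists_fold_of_not_isFolded hG
    have h' := h.map (Function.update id b a)
    have ht' : (G.map (Function.update id b a)).loopSubgroup (Function.update id b a o) = ⊤ :=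
      top_le_iff.1 (ht ▸ loopSubgroup_le_map _ G o)
    have hrank := h'.two_mul_card_add_le ht'
    have hle : traced w (Function.update id b a ∘ p) ≤ G.map (Function.update id b a) := by
      rw [traced_comp]
      exact map_mono _ hp
    have hdrop : #(G.map (Function.update id b a)).darts + #(traced w p).darts ≤
        #(traced w (Function.update id b a ∘ p)).darts + #G.darts := by
      rw [traced_comp]
      exact card_image_add_card_le (darts_subset hp) _
    obtain ⟨c, hc⟩ := (traced w p).even_card_darts
    unfold RankLE at hr
    exact ih h' ht' (by unfold RankLE; omega) hle (by omega) (by omega)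

end Traced

end LabeledGraph

/-- The element `g` lies in the subgroup generated by all but one of `card α` generators of the
free group. -/
def OmitsGenerator {α : Type*} [Fintype α] (g : FreeGroup α) : Prop :=
  ∃ (B : Finset (FreeGroup α)) (b : FreeGroup α), #B + 1 ≤ Fintype.card α ∧
    Subgroup.closure (insert b ↑B) = ⊤ ∧ g ∈ Subgroup.closure ↑B

open LabeledGraph in
theorem OmitsGenerator.exists_traced [Infinite V] [DecidableEq V] [Fintype α] [DecidableEq α]
    {n : ℕ} {w : Fin (n + 1) → α × Bool} (hw : FreeGroup.IsReduced (List.ofFn w))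
    (h : OmitsGenerator (FreeGroup.mk (List.ofFn w))) {D : ℕ} (hD : Fintype.card α ≤ D) :
    ∃ p : Fin (n + 1) → V,
      (#(traced w p).darts ≤ 2 * D ∧ (traced w p).RankLE (Fintype.card α - 1)) ∨
      (#(traced w p).darts = 2 * D ∧ (traced w p).RankLE (Fintype.card α)) := by
  obtain ⟨B, b, hB, htop, hmem⟩ := h
  obtain ⟨G₀, o₀, hc₀, hr₀, hB₀⟩ := exists_isConnected (V := V) B
  obtain ⟨G, o, hc, hf, hr, hl⟩ := hc₀.exists_folded
  have hrank : G.RankLE (Fintype.card α - 1) := by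
    unfold RankLE at hr₀ ⊢
    omega
  have hpath : G.IsPath o (List.ofFn w) o := by
    have := hf.isPath_toWord_of_mem_loopSubgroup (hl (hB₀ hmem))
    rwa [FreeGroup.toWord_mk, hw.reduce_eq] at this
  obtain ⟨p, hp⟩ := hpath.exists_traced_le
  rcases le_or_gt #(traced w p).darts (2 * D) with hle | hgt
  · exact ⟨p, .inl ⟨hle, hrank.traced hc hp⟩⟩
  obtain ⟨G', hG', hc', hr', hb⟩ := hc.exists_attach_loop hrank b
  have htop' : G'.loopSubgroup o = ⊤ := by
    rw [← top_le_iff, ← htop, Subgroup.closure_le, Set.insert_subset_iff, ← Subgroup.closure_le]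
    exact ⟨hb, (hB₀.trans hl).trans (loopSubgroup_mono hG' o)⟩
  rw [Nat.sub_add_cancel (by omega)] at hr'
  obtain ⟨q, hq⟩ := hc'.exists_card_darts_traced_eq htop' hr' (hp.trans hG') hD hgt.le
  exact ⟨q, .inr hq⟩

end LabeledGraph

/-! ### Reduced tours of graphs -/

section SerreGraph

/-- A graph in the sense of Serre, with darts `X` and vertices `V`. -/
structure SerreGraph (X V : Type*) where
  src : X → V
  inv : X → X
  inv_involutive : Function.Involutive inv
  inv_ne : ∀ x, inv x ≠ x

namespace SerreGraph

variable {X V : Type*} {Γ : SerreGraph X V} {n : ℕ} {o : Fin (n + 1) → X}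

/-- The dart `y` continues `x` without backtracking. -/
def Continues (Γ : SerreGraph X V) (x y : X) : Prop := Γ.src y = Γ.src (Γ.inv x) ∧ y ≠ Γ.inv x

/-- The Betti number (number of edges minus number of vertices plus one) is at most `r`. -/
def RankLE (_ : SerreGraph X V) [Fintype X] [Fintype V] (r : ℕ) : Prop :=
  Fintype.card X + 2 ≤ 2 * Fintype.card V + 2 * r

/-- A closed path without backtracking that visits all vertices and traverses all edges; the index
`i + 1` wraps around. -/
structure IsReducedTour (Γ : SerreGraph X V) (o : Fin (n + 1) → X) : Prop where
  continues : ∀ i, Γ.Continues (o i) (o (i + 1))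
  exists_src_eq : ∀ v, ∃ i, Γ.src (o i) = v
  exists_eq_or_eq_inv : ∀ x, ∃ i, o i = x ∨ o i = Γ.inv x

theorem forall_of_forall_add_one {P : Fin (n + 1) → Prop} (h : ∀ i, P i → P (i + 1))
    {i : Fin (n + 1)} (hi : P i) (j : Fin (n + 1)) : P j := by
  have h0 : P 0 := by
    by_contra h0
    refine Fin.reverseInduction (motive := fun j => ¬ P j) ?_ (fun j hj hj' => hj ?_) i hi
    · exact fun hlast => h0 (Fin.last_add_one n ▸ h _ hlast)
    · exact Fin.coeSucc_eq_succ (a := j) ▸ h _ hj'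
  exact Fin.induction h0 (fun j hj => Fin.coeSucc_eq_succ (a := j) ▸ h _ hj) j

theorem IsReducedTour.exists_leaving (h : Γ.IsReducedTour o) {H : Set X}
    (hH : ∀ x, Γ.inv x ∈ H ↔ x ∈ H) {x y : X} (hx : x ∈ H) (hy : y ∉ H) :
    ∃ i, o i ∈ H ∧ o (i + 1) ∉ H := by
  by_contra! hstay
  have hmem (z : X) : ∃ i, o i ∈ H ↔ z ∈ H := by
    obtain ⟨i, hi | hi⟩ := h.exists_eq_or_eq_inv z
    · exact ⟨i, hi ▸ Iff.rfl⟩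
    · exact ⟨i, hi ▸ hH z⟩
  obtain ⟨i, hi⟩ := hmem x
  obtain ⟨j, hj⟩ := hmem y
  exact hy (hj.1 (forall_of_forall_add_one hstay (hi.2 hx) j))

section Degree

variable [DecidableEq V]

/-- The number of darts in `H` with origin `v`. -/
def degree (Γ : SerreGraph X V) (H : Finset X) (v : V) : ℕ := #{x ∈ H | Γ.src x = v}

theorem sum_degree {H : Finset X} {S : Finset V} (hS : ∀ x ∈ H, Γ.src x ∈ S) :
    ∑ v ∈ S, Γ.degree H v = #H :=
  (Finset.card_eq_sum_card_fiberwise hS).symm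

theorem degree_mono {H H' : Finset X} (h : H ⊆ H') (v : V) : Γ.degree H v ≤ Γ.degree H' v :=
  Finset.card_le_card (Finset.filter_subset_filter _ h)

theorem degree_add_two_mul_card_le {H : Finset X} {S : Finset V} (hS : ∀ x ∈ H, Γ.src x ∈ S)
    (h2 : ∀ v ∈ S, 2 ≤ Γ.degree H v) {v : V} (hv : v ∈ S) :
    Γ.degree H v + 2 * #S ≤ #H + 2 := by
  rw [← sum_degree hS, ← Finset.add_sum_erase S _ hv]
  have hsum : #(S.erase v) • 2 ≤ ∑ x ∈ S.erase v, Γ.degree H x :=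
    Finset.card_nsmul_le_sum _ _ _ fun x hx => h2 x (Finset.mem_of_mem_erase hx)
  have hcard := Finset.card_erase_add_one hv
  rw [smul_eq_mul] at hsum
  omega

theorem ncard_setOf_mem_and_continues_le (H : Finset X) {x : X} (hx : Γ.inv x ∈ H) :
    {y | y ∈ H ∧ Γ.Continues x y}.ncard ≤ Γ.degree H (Γ.src (Γ.inv x)) - 1 := by
  classical
  have : {y | y ∈ H ∧ Γ.Continues x y} =
      ↑((H.filter fun y => Γ.src y = Γ.src (Γ.inv x)).erase (Γ.inv x)) := by
    ext y
    simp only [Continues, Finset.coe_erase, Finset.coe_filter]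
    exact and_assoc.symm
  rw [this, Set.ncard_coe_finset, Finset.card_erase_of_mem (by simp [hx])]
  rfl

variable [Fintype X]

theorem IsReducedTour.two_le_degree (h : Γ.IsReducedTour o) (v : V) :
    2 ≤ Γ.degree Finset.univ v := by
  classical
  obtain ⟨i, hi⟩ := h.exists_src_eq v
  obtain ⟨j, rfl⟩ : ∃ j, i = j + 1 := ⟨i - 1, (sub_add_cancel i 1).symm⟩
  rw [← Finset.card_pair (h.continues j).2]
  refine Finset.card_le_card fun x hx => ?_
  rw [Finset.mem_insert, Finset.mem_singleton] at hx
  rcases hx with rfl | rfl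
  · simpa using hi
  · simpa [← (h.continues j).1] using hi

theorem IsReducedTour.degree_le [Fintype V] {r : ℕ} (h : Γ.IsReducedTour o)
    (hr : Γ.RankLE r) (v : V) : Γ.degree Finset.univ v ≤ 2 * r := by
  have := degree_add_two_mul_card_le (Γ := Γ) (fun _ _ => Finset.mem_univ _)
    (fun v _ => h.two_le_degree v) (Finset.mem_univ v)
  rw [Finset.card_univ, Finset.card_univ] at this
  unfold RankLE at hr
  omega

end Degree

section Rank

variable [Fintype X] [Fintype V] {r : ℕ}

theorem IsReducedTour.ncard_setOf_continues_le (h : Γ.IsReducedTour o) (hr : Γ.RankLE r) (x : X) :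
    {y | Γ.Continues x y}.ncard ≤ 2 * r - 1 := by
  classical
  have := ncard_setOf_mem_and_continues_le (Γ := Γ) Finset.univ (Finset.mem_univ (Γ.inv x))
  simp only [Finset.mem_univ, true_and] at this
  exact this.trans (Nat.sub_le_sub_right (h.degree_le hr _) 1)

theorem IsReducedTour.card_add_lt_of_notMem (h : Γ.IsReducedTour o) {H : Finset X}
    (hH : ∀ x, Γ.inv x ∈ H ↔ x ∈ H) {x y : X} (hx : x ∈ H) (hy : y ∉ H) {S : Finset V}
    (hS : ∀ x ∈ H, Γ.src x ∈ S) : #H + 2 * Fintype.card V < Fintype.card X + 2 * #S := by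
  classical
  obtain ⟨i, hi, hi'⟩ := h.exists_leaving (H := H) hH hx hy
  have hlt : ∑ v ∈ S, Γ.degree H v < ∑ v ∈ S, Γ.degree Finset.univ v := by
    refine Finset.sum_lt_sum (fun v _ => degree_mono (Finset.subset_univ _) v)
      ⟨Γ.src (Γ.inv (o i)), hS _ ((hH _).2 hi), ?_⟩
    refine Finset.card_lt_card ((Finset.ssubset_iff_of_subset
      (Finset.filter_subset_filter _ (Finset.subset_univ _))).2 ⟨o (i + 1), ?_, ?_⟩)
    · simp [(h.continues i).1]
    · exact fun hmem => hi' (Finset.mem_of_mem_filter _ hmem)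
  have hsum : ∑ v ∈ S, Γ.degree Finset.univ v + ∑ v ∈ Sᶜ, Γ.degree Finset.univ v =
      Fintype.card X := by
    rw [Finset.sum_add_sum_compl, sum_degree fun _ _ => Finset.mem_univ _, Finset.card_univ]
  have hcompl : #Sᶜ • 2 ≤ ∑ v ∈ Sᶜ, Γ.degree Finset.univ v :=
    Finset.card_nsmul_le_sum _ _ _ fun v _ => h.two_le_degree v
  have hcard := Finset.card_add_card_compl S
  rw [sum_degree hS] at hlt
  rw [smul_eq_mul] at hcompl
  omega

variable [DecidableEq V]

theorem IsReducedTour.sum_degree_sub_two_add_two_le (h : Γ.IsReducedTour o) (hr : Γ.RankLE r)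
    (S : Finset V) : ∑ v ∈ S, (Γ.degree Finset.univ v - 2) + 2 ≤ 2 * r := by
  have hle : ∑ v ∈ S, (Γ.degree Finset.univ v - 2) ≤ ∑ v, (Γ.degree Finset.univ v - 2) :=
    Finset.sum_le_sum_of_subset (Finset.subset_univ _)
  have hsum : ∑ v, (Γ.degree Finset.univ v - 2) + ∑ _v : V, 2 = Fintype.card X := by
    rw [← Finset.sum_add_distrib, ← Finset.card_univ,
      ← sum_degree (Γ := Γ) fun _ _ => Finset.mem_univ _]
    exact Finset.sum_congr rfl fun v _ => Nat.sub_add_cancel (h.two_le_degree v)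
  simp only [Finset.sum_const, Finset.card_univ, smul_eq_mul] at hsum
  unfold RankLE at hr
  omega

/-- The vertices of degree at least three. -/
def branchVerts (Γ : SerreGraph X V) : Finset V := {v | 3 ≤ Γ.degree Finset.univ v}

theorem mem_branchVerts {v : V} : v ∈ Γ.branchVerts ↔ 3 ≤ Γ.degree Finset.univ v := by
  simp [branchVerts]

theorem IsReducedTour.card_branchVerts_le (h : Γ.IsReducedTour o) (hr : Γ.RankLE r) :
    #Γ.branchVerts ≤ 2 * r := by
  calc #Γ.branchVerts = ∑ _v ∈ Γ.branchVerts, 1 := Finset.card_eq_sum_ones _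
    _ ≤ ∑ v ∈ Γ.branchVerts, (Γ.degree Finset.univ v - 2) :=
        Finset.sum_le_sum fun v hv => by rw [mem_branchVerts] at hv; omega
    _ ≤ 2 * r := by have := h.sum_degree_sub_two_add_two_le hr Γ.branchVerts; omega

theorem IsReducedTour.card_filter_src_mem_branchVerts_le (h : Γ.IsReducedTour o)
    (hr : Γ.RankLE r) : #{x | Γ.src x ∈ Γ.branchVerts} ≤ 6 * r := by
  calc #{x | Γ.src x ∈ Γ.branchVerts} = ∑ v ∈ Γ.branchVerts, Γ.degree Finset.univ v :=
        (Finset.sum_card_fiberwise_eq_card_filter _ _ _).symm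
    _ ≤ ∑ v ∈ Γ.branchVerts, 3 * (Γ.degree Finset.univ v - 2) :=
        Finset.sum_le_sum fun v hv => by rw [mem_branchVerts] at hv; omega
    _ ≤ 6 * r := by
        have := h.sum_degree_sub_two_add_two_le hr Γ.branchVerts
        rw [← Finset.mul_sum]
        omega

theorem IsReducedTour.degree_le_of_notMem (h : Γ.IsReducedTour o) (hr : Γ.RankLE r)
    {H : Finset X} (hH : ∀ x, Γ.inv x ∈ H ↔ x ∈ H) (hleaf : ∀ v, Γ.degree H v ≠ 1) {y : X}
    (hy : y ∉ H) (v : V) : Γ.degree H v ≤ 2 * r - 2 := by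
  rcases Nat.eq_zero_or_pos (Γ.degree H v) with hv | hv
  · omega
  obtain ⟨x, hx⟩ := Finset.card_pos.1 hv
  rw [Finset.mem_filter] at hx
  have hS : ∀ x ∈ H, Γ.src x ∈ H.image Γ.src := fun x => Finset.mem_image_of_mem Γ.src
  have h2 : ∀ v ∈ H.image Γ.src, 2 ≤ Γ.degree H v := by
    intro v hv
    obtain ⟨z, hz, rfl⟩ := Finset.mem_image.1 hv
    have hpos : 0 < Γ.degree H (Γ.src z) := Finset.card_pos.2 ⟨z, Finset.mem_filter.2 ⟨hz, rfl⟩⟩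
    have := hleaf (Γ.src z)
    omega
  have hdeg := degree_add_two_mul_card_le hS h2 (hx.2 ▸ hS x hx.1)
  have hlt := h.card_add_lt_of_notMem hH hx.1 hy hS
  obtain ⟨a, ha⟩ := even_card_of_involutive Γ.inv_involutive Γ.inv_ne fun x hx => (hH x).2 hx
  obtain ⟨b, hb⟩ :=
    even_card_of_involutive Γ.inv_involutive Γ.inv_ne (s := Finset.univ) (by simp)
  rw [Finset.card_univ] at hb
  unfold RankLE at hr
  omega

/-- The dart `y` continues `x`, and both lie in `H` unless they meet at a vertex of degree two. -/
def ContinuesWithin (Γ : SerreGraph X V) (H : Finset X) (x y : X) : Prop :=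
  Γ.Continues x y ∧ (Γ.src (Γ.inv x) ∈ Γ.branchVerts → x ∈ H ∧ y ∈ H)

theorem ncard_setOf_continuesWithin_le {H : Finset X} (hH : ∀ x, Γ.inv x ∈ H ↔ x ∈ H) {m : ℕ}
    (hm : 1 ≤ m) (hdeg : ∀ v, Γ.degree H v ≤ m + 1) (x : X) :
    {y | Γ.ContinuesWithin H x y}.ncard ≤ m := by
  classical
  by_cases hbranch : Γ.src (Γ.inv x) ∈ Γ.branchVerts
  · by_cases hx : x ∈ H
    · calc {y | Γ.ContinuesWithin H x y}.ncard ≤ {y | y ∈ H ∧ Γ.Continues x y}.ncard :=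
            Set.ncard_le_ncard (fun y hy => ⟨(hy.2 hbranch).2, hy.1⟩) (Set.toFinite _)
        _ ≤ Γ.degree H (Γ.src (Γ.inv x)) - 1 := ncard_setOf_mem_and_continues_le H ((hH x).2 hx)
        _ ≤ m := Nat.sub_le_of_le_add (hdeg _)
    · have : {y | Γ.ContinuesWithin H x y} = ∅ :=
        Set.eq_empty_of_forall_notMem fun y hy => hx (hy.2 hbranch).1
      simp [this]
  · calc {y | Γ.ContinuesWithin H x y}.ncard
        ≤ {y | y ∈ Finset.univ ∧ Γ.Continues x y}.ncard :=
          Set.ncard_le_ncard (fun y hy => ⟨Finset.mem_univ y, hy.1⟩) (Set.toFinite _)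
      _ ≤ Γ.degree Finset.univ (Γ.src (Γ.inv x)) - 1 :=
          ncard_setOf_mem_and_continues_le _ (Finset.mem_univ _)
      _ ≤ m := by
          rw [mem_branchVerts] at hbranch
          omega

end Rank

section Traversals

variable [DecidableEq X]

/-- The number of times the closed path `o` traverses the dart `x`, in either direction. -/
def traversals (Γ : SerreGraph X V) (o : Fin (n + 1) → X) (x : X) : ℕ :=
  #{i | o i = x} + #{i | Γ.inv (o i) = x}

theorem traversals_inv (o : Fin (n + 1) → X) (x : X) :
    Γ.traversals o (Γ.inv x) = Γ.traversals o x := by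
  simp only [traversals, Γ.inv_involutive.injective.eq_iff, ← Γ.inv_involutive.eq_iff (y := x)]
  simp only [eq_comm, add_comm]

theorem sum_traversals (o : Fin (n + 1) → X) (A : Finset X) :
    ∑ x ∈ A, Γ.traversals o x = #{i | o i ∈ A} + #{i | Γ.inv (o i) ∈ A} := by
  simp only [traversals, Finset.sum_add_distrib, Finset.sum_card_fiberwise_eq_card_filter]

theorem card_filter_add_one (P : Fin (n + 1) → Prop) [DecidablePred P] :
    #{i | P (i + 1)} = #{i | P i} :=
  Finset.card_equiv (Equiv.addRight 1) (by simp)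

theorem exists_traversals_le [Fintype X] {D : ℕ} (hD : 0 < D) (hX : Fintype.card X = 2 * D)
    (o : Fin (n + 1) → X) : ∃ x, Γ.traversals o x ≤ (n + 1) / D := by
  by_contra! hlt
  have hsum : #(Finset.univ : Finset X) • ((n + 1) / D + 1) ≤ ∑ x, Γ.traversals o x :=
    Finset.card_nsmul_le_sum _ _ _ fun x _ => hlt x
  simp only [sum_traversals, Finset.mem_univ, Finset.filter_true, Finset.card_univ,
    Fintype.card_fin, hX, smul_eq_mul] at hsum
  have := Nat.lt_mul_div_succ (n + 1) hD
  nlinarith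

variable [Fintype X]

/-- The darts traversed more than `t` times by the closed path `o`. -/
def frequentDarts (Γ : SerreGraph X V) (o : Fin (n + 1) → X) (t : ℕ) : Finset X :=
  {x | t < Γ.traversals o x}

theorem mem_frequentDarts {t : ℕ} {x : X} :
    x ∈ Γ.frequentDarts o t ↔ t < Γ.traversals o x := by
  simp [frequentDarts]

variable [DecidableEq V]

theorem IsReducedTour.traversals_le_sum (h : Γ.IsReducedTour o) (f : X) : Γ.traversals o f ≤
    ∑ x ∈ ({x | Γ.src x = Γ.src f} : Finset X).erase f, Γ.traversals o x := by
  rw [sum_traversals, add_comm, traversals,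
    ← card_filter_add_one fun i => o i ∈ ({x | Γ.src x = Γ.src f} : Finset X).erase f,
    ← card_filter_add_one fun i => o i = f]
  refine add_le_add (Finset.card_le_card fun i hi => ?_) (Finset.card_le_card fun i hi => ?_)
  all_goals
    obtain ⟨hsrc, hne⟩ := h.continues i
    simp only [Finset.mem_filter, Finset.mem_univ, true_and, Finset.mem_erase] at hi ⊢
    rw [hi] at hsrc hne
  · exact ⟨hne.symm, hsrc.symm⟩
  · exact ⟨hne, hsrc⟩

/-- The branch vertices all of whose darts are traversed at most `t` times by the closed path
`o`. -/
def rareBranchVerts [Fintype V] (Γ : SerreGraph X V) (o : Fin (n + 1) → X) (t : ℕ) : Finset V :=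
  {v ∈ Γ.branchVerts | ∀ x, Γ.src x = v → Γ.traversals o x ≤ t}

variable [Fintype V] {r : ℕ}

theorem mem_rareBranchVerts {t : ℕ} {v : V} : v ∈ Γ.rareBranchVerts o t ↔
    v ∈ Γ.branchVerts ∧ ∀ x, Γ.src x = v → Γ.traversals o x ≤ t :=
  Finset.mem_filter

/- The only frequent dart `f` at `v` is entered and left through the other darts at `v`, each used
at most `t` times. -/
theorem IsReducedTour.rareBranchVerts_ssubset (h : Γ.IsReducedTour o) (hr : Γ.RankLE r) {t : ℕ}
    {v : V} (hv : Γ.degree (Γ.frequentDarts o t) v = 1) :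
    Γ.rareBranchVerts o t ⊂ Γ.rareBranchVerts o (t * (2 * r)) := by
  obtain ⟨f, hf⟩ := Finset.card_eq_one.1 hv
  have hmem (x : X) : (t < Γ.traversals o x ∧ Γ.src x = v) ↔ x = f := by
    simpa [mem_frequentDarts] using Finset.ext_iff.1 hf x
  obtain ⟨hft, rfl⟩ := (hmem f).2 rfl
  have hfle : Γ.traversals o f ≤ t * (Γ.degree Finset.univ (Γ.src f) - 1) := by
    refine (h.traversals_le_sum f).trans ((Finset.sum_le_card_nsmul _ _ t fun x hx => ?_).trans ?_)
    · simp only [Finset.mem_erase, Finset.mem_filter, Finset.mem_univ, true_and] at hx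
      by_contra! hlt
      exact hx.1 ((hmem x).1 ⟨hlt, hx.2⟩)
    · rw [Finset.card_erase_of_mem (by simp), smul_eq_mul, mul_comm]
      rfl
  have hdeg := h.degree_le hr (Γ.src f)
  have hbranch : 3 ≤ Γ.degree Finset.univ (Γ.src f) := by
    by_contra! hlt
    have := hfle.trans (Nat.mul_le_mul_left t (show _ ≤ 1 by omega))
    omega
  have hle : t ≤ t * (2 * r) := Nat.le_mul_of_pos_right t (by omega)
  refine (Finset.ssubset_iff_of_subset fun u hu => ?_).2 ⟨Γ.src f, ?_, fun hrare => ?_⟩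
  · rw [mem_rareBranchVerts] at hu ⊢
    exact ⟨hu.1, fun x hx => (hu.2 x hx).trans hle⟩
  · refine mem_rareBranchVerts.2 ⟨mem_branchVerts.2 hbranch, fun x hx => ?_⟩
    rcases eq_or_ne x f with rfl | hxf
    · exact hfle.trans (Nat.mul_le_mul_left t (by omega))
    · exact (not_lt.1 fun hlt => hxf ((hmem x).1 ⟨hlt, hx⟩)).trans hle
  · exact hft.not_ge ((mem_rareBranchVerts.1 hrare).2 f rfl)

theorem IsReducedTour.exists_scale (h : Γ.IsReducedTour o) (hr : Γ.RankLE r) (t : ℕ) :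
    ∃ j ≤ 2 * r, ∀ v, Γ.degree (Γ.frequentDarts o (t * (2 * r) ^ j)) v ≠ 1 := by
  by_contra! hleaf
  have hcard : ∀ j ≤ 2 * r + 1, j ≤ #(Γ.rareBranchVerts o (t * (2 * r) ^ j)) := by
    intro j
    induction j with
    | zero => simp
    | succ j ih =>
      intro hj
      obtain ⟨v, hv⟩ := hleaf j (by omega)
      rw [pow_succ, ← mul_assoc]
      exact (ih (by omega)).trans_lt (Finset.card_lt_card (h.rareBranchVerts_ssubset hr hv))
  have := (hcard _ le_rfl).trans (Finset.card_le_card (Finset.filter_subset _ _))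
  have := h.card_branchVerts_le hr
  omega

theorem IsReducedTour.ncard_setOf_not_continuesWithin_le (h : Γ.IsReducedTour o)
    (hr : Γ.RankLE r) (t : ℕ) :
    {i | ¬ Γ.ContinuesWithin (Γ.frequentDarts o t) (o i) (o (i + 1))}.ncard ≤ 6 * r * t := by
  set Q : Finset X := {x | Γ.src x ∈ Γ.branchVerts ∧ Γ.traversals o x ≤ t} with hQ
  have hcard : #Q ≤ 6 * r := by
    refine (Finset.card_le_card fun x hx => ?_).trans (h.card_filter_src_mem_branchVerts_le hr)
    rw [hQ, Finset.mem_filter] at hx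
    exact Finset.mem_filter.2 ⟨hx.1, hx.2.1⟩
  have hsub : {i | ¬ Γ.ContinuesWithin (Γ.frequentDarts o t) (o i) (o (i + 1))} ⊆
      ↑((Finset.univ.filter fun i => o (i + 1) ∈ Q) ∪
        (Finset.univ.filter fun i => Γ.inv (o i) ∈ Q) : Finset (Fin (n + 1))) := by
    intro i hi
    have hi : Γ.src (Γ.inv (o i)) ∈ Γ.branchVerts ∧
        (t < Γ.traversals o (o i) → Γ.traversals o (o (i + 1)) ≤ t) := by
      simpa [ContinuesWithin, h.continues i, mem_frequentDarts] using hi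
    simp only [hQ, Finset.coe_union, Finset.coe_filter, Finset.mem_filter, Finset.mem_univ,
      true_and, Set.mem_union, Set.mem_ofPred_eq, traversals_inv, (h.continues i).1, hi.1]
    exact (le_or_gt _ _).symm.imp_left hi.2
  calc _ ≤ #((Finset.univ.filter fun i => o (i + 1) ∈ Q) ∪
          (Finset.univ.filter fun i => Γ.inv (o i) ∈ Q)) := by
        rw [← Set.ncard_coe_finset]
        exact Set.ncard_le_ncard hsub (Finset.finite_toSet _)
    _ ≤ ∑ x ∈ Q, Γ.traversals o x := by
        rw [sum_traversals, ← card_filter_add_one fun i => o i ∈ Q]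
        exact Finset.card_union_le _ _
    _ ≤ #Q * t := Finset.sum_le_card_nsmul _ _ _ fun x hx => (Finset.mem_filter.1 hx).2.2
    _ ≤ 6 * r * t := Nat.mul_le_mul_right t hcard

end Traversals

theorem IsReducedTour.exists_relation [Fintype X] [Fintype V] {r : ℕ} (h : Γ.IsReducedTour o)
    (hr : Γ.RankLE r) (h2 : 2 ≤ r) {D : ℕ} (hD : 0 < D) (hX : Fintype.card X = 2 * D) :
    ∃ R : X → X → Prop, (∀ x, {y | R x y}.ncard ≤ 2 * r - 3) ∧
      {i | ¬ R (o i) (o (i + 1))}.ncard ≤ 6 * r * (2 * r) ^ (2 * r) * ((n + 1) / D) := by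
  classical
  obtain ⟨y, hy⟩ := Γ.exists_traversals_le hD hX o
  obtain ⟨j, hj, hleaf⟩ := h.exists_scale hr ((n + 1) / D)
  set t := (n + 1) / D * (2 * r) ^ j with ht
  have hinv (x : X) : Γ.inv x ∈ Γ.frequentDarts o t ↔ x ∈ Γ.frequentDarts o t := by
    rw [mem_frequentDarts, mem_frequentDarts, traversals_inv]
  have hyt : y ∉ Γ.frequentDarts o t := by
    rw [mem_frequentDarts, not_lt]
    exact hy.trans (Nat.le_mul_of_pos_right _ (by positivity))
  have hdeg (v : V) : Γ.degree (Γ.frequentDarts o t) v ≤ 2 * r - 3 + 1 := by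
    have := h.degree_le_of_notMem hr hinv hleaf hyt v
    omega
  have htle : t ≤ (2 * r) ^ (2 * r) * ((n + 1) / D) := by
    rw [ht, mul_comm]
    exact Nat.mul_le_mul_right _ (Nat.pow_le_pow_right (by omega) hj)
  refine ⟨Γ.ContinuesWithin (Γ.frequentDarts o t),
    ncard_setOf_continuesWithin_le hinv (by omega) hdeg, ?_⟩
  rw [mul_assoc (6 * r)]
  exact (h.ncard_setOf_not_continuesWithin_le hr t).trans (Nat.mul_le_mul_left _ htle)

end SerreGraph

end SerreGraph

/-! ### Counting walks -/

section Walks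

variable {A β : Type*}

/-- The words of length `n + 1` read along walks in `A` that make at most `b` transitions outside
of some relation with out-degrees at most `m`. -/
def walkWords (A β : Type*) (m b n : ℕ) : Set (Fin (n + 1) → β) :=
  {w | ∃ (lab : A → β) (R : A → A → Prop) (f : Fin (n + 1) → A), w = lab ∘ f ∧
    (∀ x, {y | R x y}.ncard ≤ m) ∧ {i : Fin n | ¬ R (f i.castSucc) (f i.succ)}.ncard ≤ b}

theorem comp_mem_walkWords_of_embedding {X : Type*} (φ : X ↪ A) (lab : X → β) {R : X → X → Prop}
    {m b n : ℕ} {f : Fin (n + 1) → X} (hR : ∀ x, {y | R x y}.ncard ≤ m)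
    (hb : {i : Fin n | ¬ R (f i.castSucc) (f i.succ)}.ncard ≤ b) :
    lab ∘ f ∈ walkWords A β m b n := by
  refine ⟨Function.extend φ lab fun _ => lab (f 0), Relation.Map R φ φ, φ ∘ f, ?_, fun a => ?_, ?_⟩
  · funext i
    simp [φ.injective.extend_apply]
  · by_cases ha : a ∈ Set.range φ
    · obtain ⟨x, rfl⟩ := ha
      have : {a' | Relation.Map R φ φ (φ x) a'} = φ '' {y | R x y} := by
        ext a'
        simp [Relation.Map]
      rw [this, Set.ncard_image_of_injective _ φ.injective]
      exact hR x
    · have : {a' | Relation.Map R φ φ a a'} = ∅ :=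
        Set.eq_empty_of_forall_notMem fun a' ⟨x, _, _, hx, _⟩ => ha ⟨x, hx⟩
      simp [this]
  · simpa [Relation.map_apply_apply φ.injective φ.injective] using hb

section Count

variable [Fintype A]

theorem sum_prod_transitions_le {M : A → A → ℝ} (hM : ∀ a b, 0 ≤ M a b) {c : ℝ}
    (hc : ∀ a, ∑ b, M a b ≤ c) (hc0 : 0 ≤ c) (n : ℕ) :
    ∑ f : Fin (n + 1) → A, ∏ i : Fin n, M (f i.castSucc) (f i.succ) ≤ Fintype.card A * c ^ n := by
  induction n with
  | zero => simp
  | succ n ih =>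
    rw [← (Fin.snocEquiv fun _ : Fin (n + 2) => A).sum_comp, Fintype.sum_prod_type_right]
    calc _ = ∑ g : Fin (n + 1) → A, ∑ a : A,
            (∏ i : Fin n, M (g i.castSucc) (g i.succ)) * M (g (Fin.last n)) a := by
          refine Finset.sum_congr rfl fun g _ => Finset.sum_congr rfl fun a _ => ?_
          simp only [Fin.snocEquiv, Equiv.coe_fn_mk, Fin.prod_univ_castSucc, Fin.succ_castSucc,
            Fin.snoc_castSucc, Fin.succ_last, Fin.snoc_last]
      _ ≤ ∑ g : Fin (n + 1) → A, (∏ i : Fin n, M (g i.castSucc) (g i.succ)) * c := by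
          simp only [← Finset.mul_sum]
          gcongr with g
          · exact Finset.prod_nonneg fun i _ => hM _ _
          · exact hc _
      _ ≤ Fintype.card A * c ^ n * c := by
          rw [← Finset.sum_mul]
          exact mul_le_mul_of_nonneg_right ih hc0
      _ = Fintype.card A * c ^ (n + 1) := by ring

/- A transition outside of `R` gets the weight `x`, all others the weight `1`. -/
open Classical in
theorem ncard_setOf_walks_mul_pow_le {R : A → A → Prop} {m : ℕ} (hR : ∀ x, {y | R x y}.ncard ≤ m)
    {x : ℝ} (hx : 0 < x) (hx1 : x ≤ 1) (b n : ℕ) :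
    ({f : Fin (n + 1) → A | {i : Fin n | ¬ R (f i.castSucc) (f i.succ)}.ncard ≤ b}.ncard : ℝ) *
      x ^ b ≤ Fintype.card A * (m + Fintype.card A * x) ^ n := by
  have hM (a a' : A) : (0 : ℝ) ≤ if R a a' then 1 else x := by positivity
  have hrow (a : A) : ∑ a', (if R a a' then (1 : ℝ) else x) ≤ m + Fintype.card A * x := by
    calc ∑ a', (if R a a' then (1 : ℝ) else x) ≤ ∑ a', ((if R a a' then 1 else 0) + x) :=
          Finset.sum_le_sum fun a' _ => by split_ifs <;> linarith
      _ = ({a' | R a a'}.ncard : ℝ) + Fintype.card A * x := by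
          rw [Finset.sum_add_distrib, Finset.sum_boole, Set.ncard_eq_toFinset_card']
          simp
      _ ≤ m + Fintype.card A * x := by gcongr; exact hR a
  rw [Set.ncard_eq_toFinset_card', ← nsmul_eq_mul]
  refine le_trans ?_ (sum_prod_transitions_le hM hrow (by positivity) n)
  refine (Finset.card_nsmul_le_sum _ (fun f : Fin (n + 1) → A => ∏ i : Fin n,
      if R (f i.castSucc) (f i.succ) then (1 : ℝ) else x) _ fun f hf => ?_).trans
    (Finset.sum_le_sum_of_subset_of_nonneg (Finset.subset_univ _) fun f _ _ =>
      Finset.prod_nonneg fun i _ => hM _ _)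
  rw [Finset.prod_ite, Finset.prod_const_one, one_mul, Finset.prod_const]
  refine pow_le_pow_of_le_one hx.le hx1 ?_
  simpa [Set.ncard_eq_toFinset_card'] using hf

theorem exists_ncard_walkWords_mul_pow_le (A β : Type*) [Fintype A] [Finite β] (m : ℕ) :
    ∃ K : ℕ, ∀ x : ℝ, 0 < x → x ≤ 1 → ∀ b n, ((walkWords A β m b n).ncard : ℝ) * x ^ b ≤
      K * (m + Fintype.card A * x) ^ n := by
  classical
  have := Fintype.ofFinite ((A → β) × {R : A → A → Prop // ∀ x, {y | R x y}.ncard ≤ m})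
  refine ⟨Fintype.card ((A → β) × {R : A → A → Prop // ∀ x, {y | R x y}.ncard ≤ m}) *
    Fintype.card A, fun x hx hx1 b n => ?_⟩
  let W (q : (A → β) × {R : A → A → Prop // ∀ x, {y | R x y}.ncard ≤ m}) :
      Set (Fin (n + 1) → β) :=
    (q.1 ∘ ·) '' {f | {i : Fin n | ¬ q.2.1 (f i.castSucc) (f i.succ)}.ncard ≤ b}
  have hsub : walkWords A β m b n ⊆ ⋃ q ∈ Finset.univ, W q := by
    rintro _ ⟨lab, R, f, rfl, hR, hb⟩
    simp only [Set.mem_iUnion]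
    exact ⟨(lab, ⟨R, hR⟩), Finset.mem_univ _, f, hb, rfl⟩
  have hW (q) : ((W q).ncard : ℝ) * x ^ b ≤ Fintype.card A * (m + Fintype.card A * x) ^ n :=
    le_trans (by gcongr; exact Set.ncard_image_le (Set.toFinite _))
      (ncard_setOf_walks_mul_pow_le q.2.2 hx hx1 b n)
  calc ((walkWords A β m b n).ncard : ℝ) * x ^ b ≤ (∑ q, ((W q).ncard : ℝ)) * x ^ b := by
        gcongr
        exact_mod_cast (Set.ncard_le_ncard hsub (Set.toFinite _)).trans
          (Finset.set_ncard_biUnion_le _ _)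
    _ = ∑ q, ((W q).ncard : ℝ) * x ^ b := Finset.sum_mul _ _ _
    _ ≤ ∑ _q, Fintype.card A * (m + Fintype.card A * x) ^ n := Finset.sum_le_sum fun q _ => hW q
    _ = _ := by
        rw [Finset.sum_const, Finset.card_univ, nsmul_eq_mul, Nat.cast_mul, mul_assoc]

end Count

theorem exists_scale_mul_rpow_le (m c k : ℕ) {ε : ℝ} (hε : 0 < ε) : ∃ D : ℕ, k ≤ D ∧ 0 < D ∧
    ε ≤ 4 * D ∧ (m + ε / 2) * (4 * D / ε) ^ ((c : ℝ) / D) ≤ m + ε := by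
  have hdiv : Filter.Tendsto (fun D : ℕ => 4 * (D : ℝ) / ε) Filter.atTop Filter.atTop :=
    (tendsto_natCast_atTop_atTop.const_mul_atTop (by norm_num)).atTop_div_const hε
  have hlim : Filter.Tendsto (fun D : ℕ => (m + ε / 2) * (4 * (D : ℝ) / ε) ^ ((c : ℝ) / D))
      Filter.atTop (nhds ((m + ε / 2) * 1)) := by
    refine .const_mul _ (((tendsto_rpow_div_mul_add c (ε / 4) 0 (by positivity)).comp hdiv).congr
      fun D => ?_)
    simp only [Function.comp_apply]
    congr 2
    field_simp
    ring
  obtain ⟨D, hle, hk, h0, h1⟩ := ((hlim.eventually_le_const (u := m + ε) (by linarith)).and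
    ((Filter.eventually_ge_atTop k).and ((Filter.eventually_gt_atTop 0).and
      (hdiv.eventually_ge_atTop 1)))).exists
  exact ⟨D, hk, h0, (one_le_div₀ hε).1 h1, hle⟩

theorem exists_ncard_walkWords_le (β : Type*) [Finite β] (m c k : ℕ) {ε : ℝ} (hε : 0 < ε) :
    ∃ D, k ≤ D ∧ ∃ K : ℝ, 0 ≤ K ∧ ∀ n,
      ((walkWords (Fin (2 * D)) β m (c * ((n + 1) / D)) n).ncard : ℝ) ≤ K * (m + ε) ^ n := by
  obtain ⟨D, hkD, hD, hεD, hle⟩ := exists_scale_mul_rpow_le m c k hε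
  obtain ⟨K, hK⟩ := exists_ncard_walkWords_mul_pow_le (Fin (2 * D)) β m
  set y : ℝ := (4 * D / ε) ^ ((c : ℝ) / D) with hy
  refine ⟨D, hkD, K * y, by positivity, fun n => ?_⟩
  have hwords := hK (4 * D / ε)⁻¹ (by positivity) (inv_le_one_of_one_le₀ ((one_le_div₀ hε).2 hεD))
    (c * ((n + 1) / D)) n
  have hbase : (m + Fintype.card (Fin (2 * D)) * (4 * D / ε)⁻¹ : ℝ) = m + ε / 2 := by
    rw [Fintype.card_fin]
    push_cast
    field_simp
    ring
  have hpow : (4 * D / ε) ^ (c * ((n + 1) / D)) ≤ y ^ (n + 1) := by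
    rw [hy, ← Real.rpow_natCast, ← Real.rpow_natCast, ← Real.rpow_mul (by positivity)]
    refine Real.rpow_le_rpow_of_exponent_le ((one_le_div₀ hε).2 hεD) ?_
    push_cast
    rw [div_mul_eq_mul_div, mul_div_assoc]
    gcongr
    exact_mod_cast Nat.cast_div_le (α := ℝ) (m := n + 1) (n := D)
  rw [hbase, inv_pow, ← div_eq_mul_inv, div_le_iff₀ (by positivity)] at hwords
  calc ((walkWords (Fin (2 * D)) β m (c * ((n + 1) / D)) n).ncard : ℝ)
      ≤ K * (m + ε / 2) ^ n * (4 * D / ε) ^ (c * ((n + 1) / D)) := hwords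
    _ ≤ K * (m + ε / 2) ^ n * y ^ (n + 1) := by gcongr
    _ = K * y * ((m + ε / 2) * y) ^ n := by rw [mul_pow]; ring
    _ ≤ K * y * (m + ε) ^ n := by gcongr

end Walks

/-! ### Cyclically reduced words in subgroups omitting a generator -/

section Traced

variable {V α : Type*}

/-- The graph in the sense of Serre obtained by forgetting the labels. -/
def LabeledGraph.toSerreGraph (G : LabeledGraph V α) : SerreGraph G.darts G.verts where
  src x := ⟨x.1.1, G.fst_mem x.1 x.2⟩
  inv x := ⟨revDart x.1, G.revDart_mem x.1 x.2⟩
  inv_involutive x := Subtype.ext (revDart_involutive x.1)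
  inv_ne x hx := revDart_ne x.1 (congrArg Subtype.val hx)

theorem LabeledGraph.rankLE_toSerreGraph {G : LabeledGraph V α} {r : ℕ} :
    G.toSerreGraph.RankLE r ↔ G.RankLE r := by
  simp [SerreGraph.RankLE, LabeledGraph.RankLE]

theorem apply_add_one_ne_of_isCyclicallyReduced {n : ℕ} {w : Fin (n + 1) → α × Bool}
    (hw : FreeGroup.IsCyclicallyReduced (List.ofFn w)) (i : Fin (n + 1)) :
    w (i + 1) ≠ ((w i).1, !(w i).2) := by
  suffices h : (w i).1 = (w (i + 1)).1 → (w i).2 = (w (i + 1)).2 by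
    intro heq
    simp [heq] at h
  refine Fin.lastCases ?_ (fun j => ?_) i
  · rw [Fin.last_add_one]
    refine hw.2 _ ?_ _ (by simp)
    simp [List.getLast?_eq_getElem?, -List.ofFn_succ, Fin.last]
  · rw [Fin.coeSucc_eq_succ]
    have := List.isChain_iff_getElem.1 hw.1 j (by simp)
    rwa [List.getElem_ofFn, List.getElem_ofFn] at this

variable {n : ℕ} {w : Fin (n + 1) → α × Bool}

open LabeledGraph

section IsReducedTour

variable [DecidableEq V] [DecidableEq α]

theorem cyclicDart_mem_traced (w : Fin (n + 1) → α × Bool) (p : Fin (n + 1) → V)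
    (i : Fin (n + 1)) : cyclicDart w p i ∈ (traced w p).darts :=
  mem_darts_traced.2 (.inl ⟨i, rfl⟩)

theorem isReducedTour_traced (hw : FreeGroup.IsCyclicallyReduced (List.ofFn w))
    (p : Fin (n + 1) → V) :
    (traced w p).toSerreGraph.IsReducedTour fun i => ⟨_, cyclicDart_mem_traced w p i⟩ where
  continues i := by
    refine ⟨rfl, fun h => apply_add_one_ne_of_isCyclicallyReduced hw i ?_⟩
    exact congrArg (fun x => x.1.2.1) h
  exists_src_eq := by
    rintro ⟨v, hv⟩
    obtain ⟨i, -, rfl⟩ := Finset.mem_image.1 hv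
    exact ⟨i, rfl⟩
  exists_eq_or_eq_inv := by
    rintro ⟨x, hx⟩
    rcases mem_darts_traced.1 hx with ⟨i, hi⟩ | ⟨i, hi⟩
    · exact ⟨i, .inl (Subtype.ext hi)⟩
    · exact ⟨i, .inr (Subtype.ext hi)⟩

end IsReducedTour

theorem OmitsGenerator.mem_walkWords [Fintype α] (hα : 2 ≤ Fintype.card α)
    (hw : FreeGroup.IsCyclicallyReduced (List.ofFn w))
    (h : OmitsGenerator (FreeGroup.mk (List.ofFn w))) {D : ℕ} (hD : Fintype.card α ≤ D) :
    w ∈ walkWords (Fin (2 * D)) (α × Bool) (2 * Fintype.card α - 3)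
      (6 * Fintype.card α * (2 * Fintype.card α) ^ (2 * Fintype.card α) * ((n + 1) / D)) n := by
  classical
  obtain ⟨p, hp⟩ := h.exists_traced (V := ℕ) hw.isReduced hD
  have htour := isReducedTour_traced hw p
  set o : Fin (n + 1) → (traced w p).darts := fun i => ⟨_, cyclicDart_mem_traced w p i⟩
  obtain ⟨R, hR, hb⟩ : ∃ R : (traced w p).darts → (traced w p).darts → Prop,
      (∀ x, {y | R x y}.ncard ≤ 2 * Fintype.card α - 3) ∧ {i | ¬ R (o i) (o (i + 1))}.ncard ≤
        6 * Fintype.card α * (2 * Fintype.card α) ^ (2 * Fintype.card α) * ((n + 1) / D) := by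
    rcases hp with ⟨-, hr⟩ | ⟨hX, hr⟩
    · refine ⟨(traced w p).toSerreGraph.Continues, fun x => ?_, ?_⟩
      · have := htour.ncard_setOf_continues_le (rankLE_toSerreGraph.2 hr) x
        omega
      · simp [htour.continues]
    · exact htour.exists_relation (rankLE_toSerreGraph.2 hr) hα (by omega)
        ((Fintype.card_coe _).trans hX)
  obtain ⟨φ⟩ : Nonempty ((traced w p).darts ↪ Fin (2 * D)) :=
    Function.Embedding.nonempty_of_card_le (by
      rw [Fintype.card_coe, Fintype.card_fin]
      exact hp.elim (·.1) (·.1.le))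
  refine comp_mem_walkWords_of_embedding φ (fun x => x.1.2.1) (f := o) hR ?_
  refine le_trans ?_ hb
  refine Set.ncard_le_ncard_of_injOn Fin.castSucc (fun i hi => ?_)
    (Fin.castSucc_injective n).injOn (Set.toFinite _)
  simpa [Fin.coeSucc_eq_succ] using hi

/-- The nonempty cyclically reduced words of length `n + 1` that represent elements omitting a
generator. -/
def cyclicOmittingWords (α : Type*) [Fintype α] (n : ℕ) : Set (Fin (n + 1) → α × Bool) :=
  {w | FreeGroup.IsCyclicallyReduced (List.ofFn w) ∧
    OmitsGenerator (FreeGroup.mk (List.ofFn w))}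

theorem exists_ncard_cyclicOmittingWords_le [Fintype α] (hα : 2 ≤ Fintype.card α) {ε : ℝ}
    (hε : 0 < ε) : ∃ K : ℝ, 0 ≤ K ∧ ∀ n, ((cyclicOmittingWords α n).ncard : ℝ) ≤
      K * ((2 * Fintype.card α - 3 : ℕ) + ε) ^ n := by
  obtain ⟨D, hD, K, hK, hwords⟩ :=
    exists_ncard_walkWords_le (α × Bool) (2 * Fintype.card α - 3)
      (6 * Fintype.card α * (2 * Fintype.card α) ^ (2 * Fintype.card α)) (Fintype.card α) hε
  refine ⟨K, hK, fun n => le_trans ?_ (hwords n)⟩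
  exact_mod_cast Set.ncard_le_ncard
    (fun w (hw : w ∈ cyclicOmittingWords α n) => hw.2.mem_walkWords hα hw.1 hD) (Set.toFinite _)

end Traced

/-! ### Elements of proper free factors -/

section FreeFactor

section Basis

variable {ι κ G : Type*} [Group G]

theorem closure_range_basis (b : FreeGroupBasis ι G) : Subgroup.closure (Set.range b) = ⊤ := by
  have h : Set.range b = b.repr.symm.toMonoidHom '' Set.range FreeGroup.of :=
    Set.range_comp b.repr.symm FreeGroup.of
  rw [h, ← MonoidHom.map_closure, FreeGroup.closure_range_of, ← MonoidHom.range_eq_map,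
    MonoidHom.range_eq_top]
  exact b.repr.symm.surjective

theorem closure_range_coe_basis {H : Subgroup G} (b : FreeGroupBasis ι H) :
    Subgroup.closure (Set.range fun i => (b i : G)) = H := by
  have h : Set.range (fun i => (b i : G)) = H.subtype '' Set.range b :=
    Set.range_comp Subtype.val b
  rw [h, ← MonoidHom.map_closure, closure_range_basis, ← MonoidHom.range_eq_map,
    Subgroup.range_subtype]

/- Both sides count the homomorphisms to `ℤ / 2`. -/
theorem card_basis_add_card_basis_eq {α : Type*} [Fintype α] {H K : Subgroup (FreeGroup α)}
    (hb : Function.Bijective (Monoid.Coprod.lift H.subtype K.subtype))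
    (bH : FreeGroupBasis ι H) (bK : FreeGroupBasis κ K) :
    Finite ι ∧ Finite κ ∧ Nat.card ι + Nat.card κ = Fintype.card α := by
  let M := Multiplicative (ZMod 2)
  have : Finite M := inferInstanceAs (Finite (ZMod 2))
  have : Nontrivial M := inferInstanceAs (Nontrivial (ZMod 2))
  have hM : Nat.card M = 2 := Nat.card_zmod 2
  let Φ : (ι ⊕ κ → M) ≃ (α → M) :=
    (Equiv.sumArrowEquivProdArrow ι κ M).trans <|
      (Equiv.prodCongr bH.lift bK.lift).trans <|
        Monoid.Coprod.liftEquiv.trans <|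
          ((MulEquiv.ofBijective _ hb).monoidHomCongrLeftEquiv (N := M)).trans FreeGroup.lift.symm
  have : Finite (ι ⊕ κ → M) := Finite.of_equiv _ Φ.symm
  have hfin : Finite (ι ⊕ κ) := by
    by_contra hinf
    rw [not_finite_iff_infinite] at hinf
    exact not_finite (ι ⊕ κ → M)
  have hι : Finite ι := Finite.of_injective (Sum.inl : ι → ι ⊕ κ) Sum.inl_injective
  have hκ : Finite κ := Finite.of_injective (Sum.inr : κ → ι ⊕ κ) Sum.inr_injective
  refine ⟨hι, hκ, ?_⟩
  have hcard := Nat.card_congr Φ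
  rw [Nat.card_fun, Nat.card_fun, hM, Nat.card_sum, Nat.card_eq_fintype_card (α := α)] at hcard
  exact Nat.pow_right_injective le_rfl hcard

end Basis

theorem omitsGenerator_of_closure_union {α : Type*} [Fintype α]
    {S T : Finset (FreeGroup α)} (hcard : #S + #T ≤ Fintype.card α)
    (htop : Subgroup.closure (S ∪ T : Set (FreeGroup α)) = ⊤) (hT : T.Nonempty) {g : FreeGroup α}
    (hg : g ∈ Subgroup.closure (S : Set (FreeGroup α))) : OmitsGenerator g := by
  classical
  obtain ⟨t, ht⟩ := hT
  refine ⟨S ∪ T.erase t, t, ?_, top_le_iff.1 (htop ▸ Subgroup.closure_mono ?_), ?_⟩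
  · have := Finset.card_union_le S (T.erase t)
    have := Finset.card_erase_add_one ht
    omega
  · rw [← Finset.coe_insert, ← Finset.union_insert, Finset.insert_erase ht, Finset.coe_union]
  · exact Subgroup.closure_mono (by simp) hg

theorem IsFreeFactor.omitsGenerator {α : Type u} [Fintype α] {H : Subgroup (FreeGroup α)}
    (hH : IsFreeFactor H) (hne : H ≠ ⊤) {g : FreeGroup α} (hg : g ∈ H) : OmitsGenerator g := by
  classical
  obtain ⟨K, hb⟩ := hH
  obtain ⟨ι, ⟨bH⟩⟩ := (inferInstance : IsFreeGroup H).nonempty_basis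
  obtain ⟨κ, ⟨bK⟩⟩ := (inferInstance : IsFreeGroup K).nonempty_basis
  obtain ⟨hι, hκ, hcard⟩ := card_basis_add_card_basis_eq hb bH bK
  have := Fintype.ofFinite ι
  have := Fintype.ofFinite κ
  have hsup : H ⊔ K = ⊤ := by
    simpa [MonoidHom.range_eq_top.2 hb.2] using (Monoid.Coprod.range_lift H.subtype K.subtype).symm
  have hS : Subgroup.closure (Finset.univ.image fun i => (bH i : FreeGroup α)) = H := by
    simpa using closure_range_coe_basis bH
  have hT : Subgroup.closure (Finset.univ.image fun i => (bK i : FreeGroup α)) = K := by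
    simpa using closure_range_coe_basis bK
  refine omitsGenerator_of_closure_union (T := Finset.univ.image fun i => (bK i : FreeGroup α))
    ?_ ?_ ?_ (hS.symm ▸ hg)
  · rw [Nat.card_eq_fintype_card, Nat.card_eq_fintype_card] at hcard
    exact hcard ▸ add_le_add Finset.card_image_le Finset.card_image_le
  · rw [Subgroup.closure_union, hS, hT, hsup]
  · by_contra hempty
    rw [Finset.not_nonempty_iff_eq_empty.1 hempty, Finset.coe_empty, Subgroup.closure_empty] at hT
    exact hne (by rw [← hsup, ← hT, sup_bot_eq])

theorem OmitsGenerator.map_mulEquiv {α : Type*} [Fintype α] {g : FreeGroup α}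
    (h : OmitsGenerator g) (φ : FreeGroup α ≃* FreeGroup α) : OmitsGenerator (φ g) := by
  obtain ⟨B, b, hB, htop, hg⟩ := h
  refine ⟨B.map φ.toEquiv.toEmbedding, φ b, by rwa [Finset.card_map], ?_, ?_⟩
  · have := congrArg (Subgroup.map φ.toMonoidHom) htop
    rw [MonoidHom.map_closure, Set.image_insert_eq, ← MonoidHom.range_eq_map,
      MonoidHom.range_eq_top.2 φ.surjective] at this
    simpa using this
  · have := Subgroup.mem_map_of_mem φ.toMonoidHom hg
    rw [MonoidHom.map_closure] at this
    simpa using this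

section Conjugates

variable {α : Type*}

/-- The elements represented by the words `u c u⁻¹`, where `u` has length `j` and `c` is a
cyclically reduced word of length `n + 1` omitting a generator. -/
def conjugatesOfLength (α : Type*) [Fintype α] (j n : ℕ) : Set (FreeGroup α) :=
  (fun q : (Fin j → α × Bool) × (Fin (n + 1) → α × Bool) => FreeGroup.mk
    (List.ofFn q.1 ++ List.ofFn q.2 ++ FreeGroup.invRev (List.ofFn q.1))) ''
    (Set.univ ×ˢ cyclicOmittingWords α n)

variable [Fintype α]

theorem finite_conjugatesOfLength (j n : ℕ) : (conjugatesOfLength α j n).Finite :=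
  (Set.toFinite _).image _

theorem ncard_conjugatesOfLength_le {K c : ℝ} (hcα : 2 * Fintype.card α ≤ c ^ 2)
    (h : ∀ n, ((cyclicOmittingWords α n).ncard : ℝ) ≤ K * c ^ n) (j n : ℕ) :
    ((conjugatesOfLength α j n).ncard : ℝ) ≤ K * c ^ (2 * j + n) := by
  have hle : (conjugatesOfLength α j n).ncard ≤
      (2 * Fintype.card α) ^ j * (cyclicOmittingWords α n).ncard := by
    refine (Set.ncard_image_le (Set.toFinite _)).trans_eq ?_
    simp [Set.ncard_prod, Nat.card_eq_fintype_card, mul_comm]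
  calc ((conjugatesOfLength α j n).ncard : ℝ)
      ≤ (2 * Fintype.card α) ^ j * ((cyclicOmittingWords α n).ncard : ℝ) := by exact_mod_cast hle
    _ ≤ (c ^ 2) ^ j * (K * c ^ n) := by
        gcongr
        exact h n
    _ = K * c ^ (2 * j + n) := by ring

variable [DecidableEq α]

theorem OmitsGenerator.exists_mem_conjugatesOfLength {g : FreeGroup α} (h : OmitsGenerator g)
    (hg : g ≠ 1) : ∃ j n, 2 * j + n + 1 = g.norm ∧ g ∈ conjugatesOfLength α j n := by
  have hdecomp := FreeGroup.reduceCyclically.conj_conjugator_reduceCyclically g.toWord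
  set u := FreeGroup.reduceCyclically.conjugator g.toWord
  set c := FreeGroup.reduceCyclically g.toWord
  have hconj : FreeGroup.mk (u ++ c ++ FreeGroup.invRev u) = g := by
    rw [hdecomp, FreeGroup.mk_toWord]
  have hlen : 2 * u.length + c.length = g.norm := by
    have := congrArg List.length hdecomp
    simp only [List.length_append, FreeGroup.invRev_length] at this
    unfold FreeGroup.norm
    omega
  have hcyc : FreeGroup.IsCyclicallyReduced c :=
    FreeGroup.reduceCyclically.isCyclicallyReduced FreeGroup.isReduced_toWord
  have homits : OmitsGenerator (FreeGroup.mk c) := by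
    have hc : MulAut.conj (FreeGroup.mk u)⁻¹ g = FreeGroup.mk c := by
      rw [← hconj, ← FreeGroup.mul_mk, ← FreeGroup.mul_mk, ← FreeGroup.inv_mk, MulAut.conj_apply]
      group
    exact hc ▸ h.map_mulEquiv _
  obtain ⟨n, hn⟩ : ∃ n, c.length = n + 1 := by
    refine Nat.exists_eq_succ_of_ne_zero fun h0 => hg ?_
    rw [← hconj, List.eq_nil_of_length_eq_zero h0, List.append_nil, ← FreeGroup.mul_mk,
      ← FreeGroup.inv_mk, mul_inv_cancel]
  obtain ⟨w, hw⟩ : ∃ w : Fin (n + 1) → α × Bool, List.ofFn w = c :=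
    ⟨fun i => c.get (i.cast hn.symm), by rw [← List.ofFn_congr hn]; exact List.ofFn_get c⟩
  refine ⟨u.length, n, by omega, (u.get, w), ⟨Set.mem_univ _, ?_⟩, ?_⟩
  · exact ⟨hw ▸ hcyc, hw ▸ homits⟩
  · simp only [List.ofFn_get, hw, hconj]

theorem setOf_omitsGenerator_subset (N : ℕ) (hN : 0 < N) :
    {g : FreeGroup α | g.norm = N ∧ OmitsGenerator g} ⊆
      ⋃ j ∈ Finset.range ((N + 1) / 2), conjugatesOfLength α j (N - 2 * j - 1) := by
  rintro g ⟨rfl, h⟩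
  obtain ⟨j, n, hn, hmem⟩ := h.exists_mem_conjugatesOfLength
    fun h => hN.ne' (FreeGroup.norm_eq_zero.2 h)
  simp only [Set.mem_iUnion]
  refine ⟨j, Finset.mem_range.2 (by omega), ?_⟩
  rwa [show g.norm - 2 * j - 1 = n by omega]

theorem finite_setOf_norm_eq_and_omitsGenerator (N : ℕ) (hN : 0 < N) :
    {g : FreeGroup α | g.norm = N ∧ OmitsGenerator g}.Finite :=
  (Set.Finite.biUnion (Finset.finite_toSet _) fun _ _ => finite_conjugatesOfLength _ _).subset
    (setOf_omitsGenerator_subset N hN)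

theorem exists_ncard_setOf_omitsGenerator_le (hα : 3 ≤ Fintype.card α) {ε : ℝ} (hε : 0 < ε) :
    ∃ K : ℝ, 0 ≤ K ∧ ∀ N, 0 < N →
      ({g : FreeGroup α | g.norm = N ∧ OmitsGenerator g}.ncard : ℝ) ≤
        N * (K * (2 * Fintype.card α - 3 + ε) ^ N) := by
  obtain ⟨K, hK, hle⟩ := exists_ncard_cyclicOmittingWords_le (α := α) (by omega) hε
  have hα' : (3 : ℝ) ≤ Fintype.card α := by exact_mod_cast hα
  rw [Nat.cast_sub (by omega)] at hle
  push_cast at hle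
  set c : ℝ := 2 * Fintype.card α - 3 + ε
  have hcα : 2 * Fintype.card α ≤ c ^ 2 := by
    nlinarith
  have hc1 : 1 ≤ c := by linarith
  refine ⟨K, hK, fun N hN => ?_⟩
  have hterm : ∀ j ∈ Finset.range ((N + 1) / 2),
      ((conjugatesOfLength α j (N - 2 * j - 1)).ncard : ℝ) ≤ K * c ^ N := by
    intro j hj
    rw [Finset.mem_range] at hj
    refine (ncard_conjugatesOfLength_le hcα hle _ _).trans ?_
    gcongr
    omega
  calc _ ≤ ((∑ j ∈ Finset.range ((N + 1) / 2),
          (conjugatesOfLength α j (N - 2 * j - 1)).ncard : ℕ) : ℝ) := by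
        have hfin := Set.Finite.biUnion (Finset.range ((N + 1) / 2)).finite_toSet
          fun j _ => finite_conjugatesOfLength (α := α) j (N - 2 * j - 1)
        exact_mod_cast (Set.ncard_le_ncard (setOf_omitsGenerator_subset N hN) hfin).trans
          (Finset.set_ncard_biUnion_le _ _)
    _ ≤ #(Finset.range ((N + 1) / 2)) • (K * c ^ N) := by
        rw [Nat.cast_sum]
        exact Finset.sum_le_card_nsmul _ _ _ hterm
    _ ≤ N * (K * c ^ N) := by
        rw [nsmul_eq_mul, Finset.card_range]
        gcongr
        omega

end Conjugates

theorem exists_ncard_properFreeFactorWords_le {k : ℕ} (hk : 3 ≤ k) {ε : ℝ} (hε : 0 < ε) :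
    ∃ K : ℝ, 0 ≤ K ∧ ∀ N, 0 < N →
      ((properFreeFactorWords k N).ncard : ℝ) ≤ N * (K * (2 * k - 3 + ε) ^ N) := by
  obtain ⟨K, hK, hle⟩ := exists_ncard_setOf_omitsGenerator_le (α := Fin k) (by simpa) hε
  rw [Fintype.card_fin] at hle
  refine ⟨K, hK, fun N hN => le_trans ?_ (hle N hN)⟩
  have hsub : properFreeFactorWords k N ⊆ {g | g.norm = N ∧ OmitsGenerator g} :=
    fun g ⟨hg, H, hH, hne, hgH⟩ => ⟨hg, hH.omitsGenerator hne hgH⟩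
  exact_mod_cast Set.ncard_le_ncard hsub (finite_setOf_norm_eq_and_omitsGenerator N hN)

end FreeFactor

/-! ### Imprimitive elements of proper free factors -/

section LowerBound

section FreeFactorRange

variable {β : Type*} {γ : Type u} {f : β → γ}

theorem isFreeFactor_range_map_of_injective (hf : Function.Injective f) :
    IsFreeFactor (FreeGroup.map f).range := by
  classical
  let φ := FreeGroup.map f
  let θ := FreeGroup.map (Subtype.val : {c // c ∉ Set.range f} → γ)
  let ψ : FreeGroup γ →* Monoid.Coprod φ.range θ.range := FreeGroup.lift fun c =>
    if hc : c ∈ Set.range f then Monoid.Coprod.inl (φ.rangeRestrict (FreeGroup.of hc.choose))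
    else Monoid.Coprod.inr (θ.rangeRestrict (FreeGroup.of ⟨c, hc⟩))
  have hψφ : ∀ i, ψ (FreeGroup.of (f i)) =
      Monoid.Coprod.inl (φ.rangeRestrict (FreeGroup.of i)) := fun i => by
    have hi : f i ∈ Set.range f := ⟨i, rfl⟩
    simp only [ψ, FreeGroup.lift_apply_of, dif_pos hi, hf hi.choose_spec]
  have hψθ : ∀ c, ψ (FreeGroup.of c.1) =
      Monoid.Coprod.inr (θ.rangeRestrict (FreeGroup.of c)) := fun c => by
    simp only [ψ, FreeGroup.lift_apply_of, dif_neg c.2]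
  let Φ := Monoid.Coprod.lift φ.range.subtype θ.range.subtype
  have hleft : ψ.comp Φ = MonoidHom.id _ := by
    refine Monoid.Coprod.hom_ext ?_ ?_
    · refine (MonoidHom.cancel_right φ.rangeRestrict_surjective).1 ?_
      ext i
      simp [Φ, φ, hψφ]
    · refine (MonoidHom.cancel_right θ.rangeRestrict_surjective).1 ?_
      ext c
      simp [Φ, θ, hψθ]
  have hright : Φ.comp ψ = MonoidHom.id _ := by
    ext c
    by_cases hc : c ∈ Set.range f
    · obtain ⟨i, rfl⟩ := hc
      simp [Φ, φ, hψφ]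
    · simp [Φ, θ, hψθ ⟨c, hc⟩]
  exact ⟨θ.range, Function.bijective_iff_has_inverse.2
    ⟨ψ, DFunLike.congr_fun hleft, DFunLike.congr_fun hright⟩⟩

theorem range_map_ne_top (hf : ¬ Function.Surjective f) : (FreeGroup.map f).range ≠ ⊤ := by
  classical
  intro htop
  obtain ⟨c, hc⟩ := not_forall.1 hf
  let χ : FreeGroup γ →* Multiplicative ℤ :=
    FreeGroup.lift (Pi.mulSingle c (Multiplicative.ofAdd 1))
  have hχ : χ.comp (FreeGroup.map f) = 1 := by
    ext i
    simp [χ, not_exists.1 hc i]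
  obtain ⟨g, hg⟩ := MonoidHom.range_eq_top.1 htop (FreeGroup.of c)
  have := DFunLike.congr_fun hχ g
  rw [MonoidHom.comp_apply, hg] at this
  simp [χ] at this

end FreeFactorRange

theorem not_isPrimitive_of_forall_hom {G : Type u} [Group G] {M : Type*} [Group M] [Nontrivial M]
    {g : G} (hg : ∀ χ : G →* M, χ g = 1) : ¬ IsPrimitive g := by
  rintro ⟨ι, b, i, rfl⟩
  obtain ⟨m, hm⟩ := exists_ne (1 : M)
  exact hm (by simpa [FreeGroupBasis.lift] using hg (b.lift fun _ => m))

section ExponentSums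

variable {β : Type*}

theorem isReduced_append_cons {L t : List (β × Bool)} {x : β × Bool} (hL : FreeGroup.IsReduced L)
    (ht : FreeGroup.IsReduced (x :: t)) (hx : ∀ y ∈ L.getLast?, y.1 ≠ x.1) :
    FreeGroup.IsReduced (L ++ x :: t) :=
  List.isChain_append.2 ⟨hL, ht, fun y hy z hz h => by
    obtain rfl : x = z := by simpa using hz
    exact absurd h (hx y hy)⟩

variable [DecidableEq β]

/-- The homomorphism counting, with sign and modulo `3`, the occurrences of each generator. -/
def exponentSums : FreeGroup β →* Multiplicative (β → ZMod 3) :=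
  FreeGroup.lift fun i => Multiplicative.ofAdd (Pi.single i 1)

theorem exponentSums_mk_cons (i : β) (σ : Bool) (L : List (β × Bool)) :
    (exponentSums (FreeGroup.mk ((i, σ) :: L))).toAdd =
      Pi.single i (cond σ 1 (-1)) + (exponentSums (FreeGroup.mk L)).toAdd := by
  cases σ <;> simp [exponentSums, FreeGroup.lift_mk, Pi.single_neg]

theorem hom_eq_one_of_exponentSums_eq_one [Finite β] {g : FreeGroup β} (hg : exponentSums g = 1)
    (χ : FreeGroup β →* Multiplicative (ZMod 3)) : χ g = 1 := by
  have := Fintype.ofFinite β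
  let ψ := (Fintype.linearCombination (ZMod 3)
    fun i => Multiplicative.toAdd (χ (FreeGroup.of i))).toAddMonoidHom.toMultiplicative
  have hχ : χ = ψ.comp exponentSums := by
    ext i
    simp [ψ, exponentSums, Fintype.linearCombination_apply_single]
  rw [hχ, MonoidHom.comp_apply, hg, map_one]

/- The words `i^{±2} j i^{±2} j⁻¹` and `j i^{±2} j⁻¹ i^{±2}` realize every residue as the exponent
sum of `i`, and one of them can follow any given last letter. -/
theorem exists_block {i j : β} (hij : i ≠ j) {L : List (β × Bool)} (hL : FreeGroup.IsReduced L)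
    (r : ZMod 3) : ∃ t : List (β × Bool), t.length = 6 ∧ FreeGroup.IsReduced (L ++ t) ∧
      (exponentSums (FreeGroup.mk t)).toAdd = Pi.single i r := by
  obtain ⟨σ, τ, rfl⟩ : ∃ σ τ : Bool, r = (cond σ 1 (-1) + cond σ 1 (-1)) +
      (cond τ 1 (-1) + cond τ 1 (-1)) := by
    revert r
    decide
  have hnil : (exponentSums (FreeGroup.mk ([] : List (β × Bool)))).toAdd = 0 := by
    simp [← FreeGroup.one_eq_mk]
  by_cases hlast : ∀ x ∈ L.getLast?, x.1 ≠ i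
  · refine ⟨[(i, σ), (i, σ), (j, true), (i, τ), (i, τ), (j, false)], rfl,
      isReduced_append_cons hL (by simp [hij, hij.symm]) hlast, ?_⟩
    simp only [exponentSums_mk_cons, hnil, Pi.single_add, cond_true, cond_false, Pi.single_neg]
    abel
  · have hlast' : ∀ x ∈ L.getLast?, x.1 ≠ j := by
      push Not at hlast
      obtain ⟨y, hy, rfl⟩ := hlast
      exact fun x hx => Option.mem_unique hx hy ▸ hij
    refine ⟨[(j, true), (i, σ), (i, σ), (j, false), (i, τ), (i, τ)], rfl,
      isReduced_append_cons hL (by simp [hij, hij.symm]) hlast', ?_⟩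
    simp only [exponentSums_mk_cons, hnil, Pi.single_add, cond_true, cond_false, Pi.single_neg]
    abel

theorem exists_tail [Nontrivial β] (c : β → ZMod 3) (l : List β) {L : List (β × Bool)}
    (hL : FreeGroup.IsReduced L) :
    ∃ t : List (β × Bool), t.length = 6 * l.length ∧ FreeGroup.IsReduced (L ++ t) ∧
      (exponentSums (FreeGroup.mk t)).toAdd = (l.map fun i => Pi.single i (c i)).sum := by
  induction l generalizing L with
  | nil => exact ⟨[], rfl, by simpa using hL, by simp [← FreeGroup.one_eq_mk]⟩
  | cons i l ih =>
    obtain ⟨j, hj⟩ := exists_ne i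
    obtain ⟨t, ht, hred, hsum⟩ := exists_block hj.symm hL (c i)
    obtain ⟨t', ht', hred', hsum'⟩ := ih hred
    refine ⟨t ++ t', by simp [ht, ht', mul_add, add_comm], by simpa using hred', ?_⟩
    rw [← FreeGroup.mul_mk, map_mul, toAdd_mul, hsum, hsum', List.map_cons, List.sum_cons]

theorem exists_tail_exponentSums_eq_one [Nontrivial β] [Fintype β] {L : List (β × Bool)}
    (hL : FreeGroup.IsReduced L) :
    ∃ t : List (β × Bool), t.length = 6 * Fintype.card β ∧ FreeGroup.IsReduced (L ++ t) ∧
      exponentSums (FreeGroup.mk (L ++ t)) = 1 := by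
  obtain ⟨t, ht, hred, hsum⟩ :=
    exists_tail (-(exponentSums (FreeGroup.mk L)).toAdd) Finset.univ.toList hL
  refine ⟨t, by simpa using ht, hred, Multiplicative.toAdd.injective ?_⟩
  rw [← FreeGroup.mul_mk, map_mul, toAdd_mul, hsum, Finset.sum_map_toList,
    Finset.univ_sum_single, add_neg_cancel, toAdd_one]

end ExponentSums

theorem pow_le_ncard_isReduced {β : Type*} [Fintype β] [Nonempty β] (M : ℕ) :
    (2 * Fintype.card β - 1) ^ M ≤
      {L : List (β × Bool) | L.length = M ∧ FreeGroup.IsReduced L}.ncard := by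
  classical
  have hfin : ∀ M, {L : List (β × Bool) | L.length = M ∧ FreeGroup.IsReduced L}.Finite :=
    fun M => (List.finite_length_eq (β × Bool) M).subset fun L hL => hL.1
  have hnext : ∀ a : β × Bool, Nonempty (Fin (2 * Fintype.card β - 1) ↪
      {b : β × Bool // b ≠ (a.1, !a.2)}) := by
    intro a
    refine Function.Embedding.nonempty_of_card_le ?_
    rw [Fintype.card_subtype_compl, Fintype.card_subtype_eq]
    simp [mul_comm]
  let next := fun a => (hnext a).some
  obtain ⟨a₀⟩ : Nonempty (β × Bool) := inferInstance
  induction M with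
  | zero => exact (Set.ncard_pos (hfin 0)).2 ⟨[], rfl, FreeGroup.IsReduced.nil⟩
  | succ M ih =>
    calc (2 * Fintype.card β - 1) ^ (M + 1)
        ≤ ({L : List (β × Bool) | L.length = M ∧ FreeGroup.IsReduced L} ×ˢ
            (Set.univ : Set (Fin (2 * Fintype.card β - 1)))).ncard := by
          rw [Set.ncard_prod, Set.ncard_univ, Nat.card_fin, pow_succ]
          gcongr
      _ ≤ _ := Set.ncard_le_ncard_of_injOn
        (fun p => (next (p.1.head?.getD a₀) p.2).1 :: p.1) ?_ ?_ (hfin _)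
    · rintro ⟨L, c⟩ ⟨⟨rfl, hL⟩, -⟩
      refine ⟨rfl, List.isChain_cons.2 ⟨fun y hy hfst => ?_, hL⟩⟩
      have hne := (next (L.head?.getD a₀) c).2
      simp only [Option.mem_def.1 hy, Option.getD_some] at hne hfst ⊢
      by_contra hsnd
      exact hne (Prod.ext hfst (Bool.eq_not_of_ne hsnd))
    · rintro ⟨L, c⟩ - ⟨L', c'⟩ - h
      obtain ⟨hhead, rfl⟩ := List.cons.inj h
      exact Prod.ext rfl ((next _).injective (Subtype.ext hhead))

theorem isReduced_map {β γ : Type*} {f : β → γ} (hf : Function.Injective f)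
    {L : List (β × Bool)} (hL : FreeGroup.IsReduced L) :
    FreeGroup.IsReduced (L.map fun x => (f x.1, x.2)) :=
  (List.isChain_map _).2 (hL.imp fun _ _ h hab => h (hf hab))

theorem norm_map_mk {β γ : Type*} [DecidableEq γ] {f : β → γ} (hf : Function.Injective f)
    {L : List (β × Bool)} (hL : FreeGroup.IsReduced L) :
    (FreeGroup.map f (FreeGroup.mk L)).norm = L.length := by
  rw [FreeGroup.map.mk, FreeGroup.norm, FreeGroup.toWord_mk, (isReduced_map hf hL).reduce_eq,
    List.length_map]

theorem map_mk_mem_sdiff {n N : ℕ} {L : List (Fin n × Bool)} (hN : L.length = N)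
    (hL : FreeGroup.IsReduced L) (hsum : exponentSums (FreeGroup.mk L) = 1) :
    FreeGroup.map Fin.castSucc (FreeGroup.mk L) ∈
      properFreeFactorWords (n + 1) N \ primitiveWords (n + 1) N := by
  have hnorm := (norm_map_mk (Fin.castSucc_injective n) hL).trans hN
  refine ⟨⟨hnorm, _, isFreeFactor_range_map_of_injective (Fin.castSucc_injective n),
    range_map_ne_top fun h => ?_, _, rfl⟩, fun hp => ?_⟩
  · obtain ⟨i, hi⟩ := h (Fin.last n)
    exact (Fin.castSucc_lt_last i).ne hi
  · exact not_isPrimitive_of_forall_hom (M := Multiplicative (ZMod 3))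
      (fun χ => hom_eq_one_of_exponentSums_eq_one hsum (χ.comp (FreeGroup.map Fin.castSucc))) hp.2

theorem pow_le_ncard_sdiff {n : ℕ} (hn : 2 ≤ n) (M : ℕ) :
    (2 * n - 1) ^ M ≤ (properFreeFactorWords (n + 1) (M + 6 * n) \
      primitiveWords (n + 1) (M + 6 * n)).ncard := by
  have : Nontrivial (Fin n) := Fin.nontrivial_iff_two_le.2 hn
  choose! t ht hred hsum using fun (L : List (Fin n × Bool)) (hL : FreeGroup.IsReduced L) =>
    exists_tail_exponentSums_eq_one hL
  rw [Fintype.card_fin] at ht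
  have hcard := pow_le_ncard_isReduced (β := Fin n) M
  rw [Fintype.card_fin] at hcard
  refine hcard.trans (Set.ncard_le_ncard_of_injOn
    (fun L => FreeGroup.map Fin.castSucc (FreeGroup.mk (L ++ t L))) ?_ ?_
    ((properFreeFactorWords_finite _ _).subset Set.sdiff_subset))
  · rintro L ⟨rfl, hL⟩
    exact map_mk_mem_sdiff (by rw [List.length_append, ht L hL]) (hred L hL) (hsum L hL)
  · rintro L ⟨hM, hL⟩ L' ⟨hM', hL'⟩ h
    have := FreeGroup.reduce.sound (FreeGroup.map_injective (Fin.castSucc_injective n) h)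
    rw [(hred L hL).reduce_eq, (hred L' hL').reduce_eq] at this
    exact List.append_inj_left this (hM.trans hM'.symm)

end LowerBound

section Limit

open Filter Topology

variable {a : ℕ → ℝ} {l : ℝ}

theorem tendsto_const_rpow_one_div {C : ℝ} (hC : 0 < C) :
    Tendsto (fun N : ℕ => C ^ (1 / (N : ℝ))) atTop (𝓝 1) := by
  simpa [Function.comp_def] using
    ((Real.continuous_const_rpow hC.ne').tendsto 0).comp tendsto_one_div_atTop_nhds_zero_nat

theorem pow_rpow_one_div {x : ℝ} {N : ℕ} (hx : 0 ≤ x) (hN : N ≠ 0) :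
    (x ^ N) ^ (1 / (N : ℝ)) = x := by
  rw [one_div, Real.pow_rpow_inv_natCast hx hN]

theorem eventually_lt_rpow_one_div {b c : ℝ} (hl : 0 < l) (hc : 0 < c)
    (hlow : ∀ᶠ N in atTop, c * l ^ N ≤ a N) (hb : b < l) :
    ∀ᶠ N : ℕ in atTop, b < a N ^ (1 / (N : ℝ)) := by
  have hlim : Tendsto (fun N : ℕ => c ^ (1 / (N : ℝ)) * l) atTop (𝓝 l) := by
    simpa using (tendsto_const_rpow_one_div hc).mul_const l
  filter_upwards [hlim.eventually_const_lt hb, hlow, eventually_ne_atTop 0] with N hbN hlowN hN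
  calc b < c ^ (1 / (N : ℝ)) * l := hbN
    _ = (c * l ^ N) ^ (1 / (N : ℝ)) := by
        rw [Real.mul_rpow hc.le (by positivity), pow_rpow_one_div hl.le hN]
    _ ≤ a N ^ (1 / (N : ℝ)) := by gcongr

theorem eventually_rpow_one_div_lt {K b : ℝ} (hl : 0 < l) (hK : 0 ≤ K) (ha : ∀ N, 0 ≤ a N)
    (hup : ∀ N : ℕ, 0 < N → a N ≤ N * (K * l ^ N)) (hb : l < b) :
    ∀ᶠ N : ℕ in atTop, a N ^ (1 / (N : ℝ)) < b := by
  have hroot : Tendsto (fun N : ℕ => (N : ℝ) ^ (1 / (N : ℝ))) atTop (𝓝 1) :=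
    tendsto_rpow_div.comp tendsto_natCast_atTop_atTop
  have hlim : Tendsto (fun N : ℕ => (N : ℝ) ^ (1 / (N : ℝ)) * ((K + 1) ^ (1 / (N : ℝ)) * l))
      atTop (𝓝 l) := by
    simpa using hroot.mul ((tendsto_const_rpow_one_div (by positivity : 0 < K + 1)).mul_const l)
  filter_upwards [hlim.eventually_lt_const hb, eventually_gt_atTop 0] with N hbN hN
  have haN := ha N
  calc a N ^ (1 / (N : ℝ)) ≤ (N * ((K + 1) * l ^ N)) ^ (1 / (N : ℝ)) := by
        gcongr
        refine (hup N hN).trans ?_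
        gcongr
        exact le_add_of_nonneg_right zero_le_one
    _ = (N : ℝ) ^ (1 / (N : ℝ)) * ((K + 1) ^ (1 / (N : ℝ)) * l) := by
        rw [Real.mul_rpow (by positivity) (by positivity),
          Real.mul_rpow (by positivity) (by positivity), pow_rpow_one_div hl.le hN.ne']
    _ < b := hbN

theorem tendsto_rpow_one_div {c : ℝ} (hl : 0 < l) (hc : 0 < c) (ha : ∀ N, 0 ≤ a N)
    (hlow : ∀ᶠ N in atTop, c * l ^ N ≤ a N)
    (hup : ∀ ε > 0, ∃ K : ℝ, 0 ≤ K ∧ ∀ N : ℕ, 0 < N → a N ≤ N * (K * (l + ε) ^ N)) :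
    Tendsto (fun N : ℕ => a N ^ (1 / (N : ℝ))) atTop (𝓝 l) := by
  refine tendsto_order.2 ⟨fun b hb => eventually_lt_rpow_one_div hl hc hlow hb, fun b hb => ?_⟩
  obtain ⟨K, hK, hle⟩ := hup ((b - l) / 2) (by linarith)
  exact eventually_rpow_one_div_lt (by linarith) hK ha hle (by linarith)

end Limit

theorem exists_mul_pow_le_ncard_sdiff {k : ℕ} (hk : 3 ≤ k) :
    ∃ c : ℝ, 0 < c ∧ ∀ᶠ N in Filter.atTop, c * (2 * (k : ℝ) - 3) ^ N ≤
      ((properFreeFactorWords k N \ primitiveWords k N).ncard : ℝ) := by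
  obtain ⟨n, rfl⟩ : ∃ n, k = n + 1 := ⟨k - 1, by omega⟩
  have hcast : 2 * ((n + 1 : ℕ) : ℝ) - 3 = ((2 * n - 1 : ℕ) : ℝ) := by
    rw [Nat.cast_sub (by omega)]
    push_cast
    ring
  have hpos : (0 : ℝ) < (2 * n - 1 : ℕ) := by exact_mod_cast (by omega : 0 < 2 * n - 1)
  rw [hcast]
  refine ⟨(((2 * n - 1 : ℕ) : ℝ) ^ (6 * n))⁻¹, by positivity, ?_⟩
  filter_upwards [Filter.eventually_ge_atTop (6 * n)] with N hN
  obtain ⟨M, rfl⟩ := Nat.exists_eq_add_of_le' hN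
  rw [pow_add, mul_comm, mul_inv_cancel_right₀ (by positivity)]
  exact_mod_cast pow_le_ncard_sdiff (by omega) M

theorem corollary1p4 (k : ℕ) (hk : 3 ≤ k) :
    Filter.Tendsto
        (fun N : ℕ => ((properFreeFactorWords k N).ncard : ℝ) ^ (1 / (N : ℝ)))
        Filter.atTop (nhds (2 * (k : ℝ) - 3)) ∧
      Filter.Tendsto
        (fun N : ℕ => ((properFreeFactorWords k N \ primitiveWords k N).ncard : ℝ) ^ (1 / (N : ℝ)))
        Filter.atTop (nhds (2 * (k : ℝ) - 3)) := by
  have hk' : (3 : ℝ) ≤ k := by exact_mod_cast hk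
  have hle : ∀ N, ((properFreeFactorWords k N \ primitiveWords k N).ncard : ℝ) ≤
      (properFreeFactorWords k N).ncard := fun N => by
    exact_mod_cast Set.ncard_le_ncard Set.sdiff_subset (properFreeFactorWords_finite k N)
  obtain ⟨c, hc, hlow⟩ := exists_mul_pow_le_ncard_sdiff hk
  refine ⟨tendsto_rpow_one_div (by linarith) hc (fun N => by positivity)
    (hlow.mono fun N hN => hN.trans (hle N)) fun ε hε =>
      exists_ncard_properFreeFactorWords_le hk hε,
    tendsto_rpow_one_div (by linarith) hc (fun N => by positivity) hlow fun ε hε => ?_⟩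
  obtain ⟨K, hK, hup⟩ := exists_ncard_properFreeFactorWords_le hk hε
  exact ⟨K, hK, fun N hN => (hle N).trans (hup N hN)⟩
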